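/- Let $\mathbb{D}=\{z\in\mathbb{C}:|z|<1\}$. For functions $f,g$ on $\mathbb{D}$ write $f\prec g$ if there is an analytic $w:\mathbb{D}\to\mathbb{C}$ with $w(0)=0$, $|w(z)|<1$ and $f(z)=g(w(z))$ for all $z\in\mathbb{D}$. Put $\varphi_c(z)=1+\frac{4z}{3}+\frac{2z^2}{3}$ and $\mathcal{Q}(z)=e^{e^z-1}$. Let $p$ be analytic in $\mathbb{D}$ with $p(0)=1$, and let $\beta$ be real. Then each of the following conditions implies $p\prec\mathcal{Q}$: (a) $1+\beta zp'(z)\prec\varphi_c(z)$ and $\beta\ge\dfrac{1}{1-e^{e^{-1}-1}}$; (b) $1+\beta\dfrac{zp'(z)}{p(z)}\prec\varphi_c(z)$ and $\beta\ge\dfrac{e}{e-1}$; (c) $1+\beta\dfrac{zp'(z)}{p(z)^2}\prec\varphi_c(z)$ and $\beta\ge\dfrac{5e^{e-1}}{3(e^{e-1}-1)}$. The bounds are sharp: in each case, for every $\beta$ with $0\le\beta<\beta_0$, where $\beta_0$ is the stated bound, there is an analytic $p$ on $\mathbb{D}$ with $p(0)=1$ (and without zeros in $\mathbb{D}$ in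 cases (b) and (c)) that satisfies the subordination to $\varphi_c$ in that case but not $p\prec\mathcal{Q}$. -/

import Mathlib

/-- The open unit disc in the complex plane. -/
def unitDisc : Set ℂ := Metric.ball 0 1

/-- `f ≺ g` on the open unit disc: `f = g ∘ w` for an analytic self-map `w` of the disc that
fixes the origin. (Values of `f` and `g` outside the disc play no role.) -/
def Subordinate (f g : ℂ → ℂ) : Prop :=
  ∃ w : ℂ → ℂ, AnalyticOnNhd ℂ w unitDisc ∧ w 0 = 0 ∧ (∀ z ∈ unitDisc, ‖w z‖ < 1) ∧
    ∀ z ∈ unitDisc, f z = g (w z)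

/-- The function `1 + 4z/3 + 2z²/3`, mapping the disc onto the inside of a cardioid. -/
noncomputable def phiC (z : ℂ) : ℂ := 1 + 4 * z / 3 + 2 * z ^ 2 / 3

/-- The function `e^{e^z - 1}`. -/
noncomputable def bellQ (z : ℂ) : ℂ := Complex.exp (Complex.exp z - 1)

/-- `1 + β z p'(z)`. -/
noncomputable def psiOp (β : ℝ) (p : ℂ → ℂ) (z : ℂ) : ℂ :=
  1 + (β : ℂ) * (z * deriv p z)

/-- `1 + β z p'(z) / p(z)`. -/
noncomputable def lambdaOp (β : ℝ) (p : ℂ → ℂ) (z : ℂ) : ℂ :=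
  1 + (β : ℂ) * (z * deriv p z / p z)

/-- `1 + β z p'(z) / p(z)²`. -/
noncomputable def thetaOp (β : ℝ) (p : ℂ → ℂ) (z : ℂ) : ℂ :=
  1 + (β : ℂ) * (z * deriv p z / p z ^ 2)

/-- **Jack's lemma**: at a point where the modulus of an analytic function fixing the origin first
reaches `1`, the logarithmic derivative is a real number at least `1`. -/
theorem exists_mul_deriv_eq_of_norm_eq_one {f : ℂ → ℂ} {z₀ : ℂ}
    (hd : DifferentiableOn ℂ f (Metric.ball 0 ‖z₀‖)) (hd₀ : DifferentiableAt ℂ f z₀)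
    (h0 : f 0 = 0) (hlt : ∀ z, ‖z‖ < ‖z₀‖ → ‖f z‖ < 1) (h1 : ‖f z₀‖ = 1) :
    ∃ m : ℝ, 1 ≤ m ∧ z₀ * deriv f z₀ = m * f z₀ := by
  have hz₀ : z₀ ≠ 0 := by
    rintro rfl
    simp [h0] at h1
  have hn : 0 < ‖z₀‖ := norm_pos_iff.2 hz₀
  have hf₀ : f z₀ ≠ 0 := fun h => by simp [h] at h1
  have schwarz : ∀ z, ‖z‖ ≤ ‖z₀‖ → z = z₀ ∨ ‖z‖ < ‖z₀‖ → ‖f z‖ ≤ ‖z‖ / ‖z₀‖ := by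
    rintro z - (rfl | hz)
    · rw [h1, div_self hn.ne']
    · have := Complex.dist_le_div_mul_dist_of_mapsTo_ball (R₂ := 1) hd
        (fun y hy => by
          rw [h0, mem_closedBall_zero_iff]
          exact (hlt y (by simpa using hy)).le) (z := z) (by simpa using hz)
      simpa [h0, div_eq_inv_mul] using this
  set d := z₀ * deriv f z₀ / f z₀ with hdef
  have key : ∀ ξ : ℂ, ξ.re < 0 → (ξ * d).re ≤ ξ.re := by
    intro ξ hξ
    have hc : HasDerivAt (fun τ : ℝ => z₀ * Complex.exp (τ * ξ)) (z₀ * ξ) 0 := by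
      have h2 : HasDerivAt (fun τ : ℂ => z₀ * Complex.exp (τ * ξ))
          (z₀ * (Complex.exp (((0 : ℝ) : ℂ) * ξ) * (1 * ξ))) ((0 : ℝ) : ℂ) :=
        (((hasDerivAt_id _).mul_const ξ).cexp).const_mul z₀
      simpa using h2.comp_ofReal
    have hF : HasDerivAt (fun τ : ℝ => f (z₀ * Complex.exp (τ * ξ)) / f z₀) (ξ * d) 0 := by
      have h2 : HasDerivAt f (deriv f z₀) ((fun τ : ℝ => z₀ * Complex.exp (τ * ξ)) 0) := by
        simpa using hd₀.hasDerivAt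
      have h3 := (h2.comp (0 : ℝ) hc).div_const (f z₀)
      exact h3.congr_deriv (by rw [hdef]; ring)
    have hre : HasDerivAt (fun τ : ℝ => (f (z₀ * Complex.exp (τ * ξ)) / f z₀).re
        - Real.exp (τ * ξ.re)) ((ξ * d).re - ξ.re) 0 := by
      have h2 : HasDerivAt (fun τ : ℝ => Real.exp (τ * ξ.re))
          (Real.exp (0 * ξ.re) * (1 * ξ.re)) 0 :=
        ((hasDerivAt_id (0 : ℝ)).mul_const ξ.re).exp
      have h3 : HasDerivAt (fun τ : ℝ => (f (z₀ * Complex.exp (τ * ξ)) / f z₀).re) (ξ * d).re 0 :=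
        Complex.reCLM.hasFDerivAt.comp_hasDerivAt (0 : ℝ) hF
      exact (h3.sub h2).congr_deriv (by simp)
    have hle : ∀ τ : ℝ, 0 < τ → (f (z₀ * Complex.exp (τ * ξ)) / f z₀).re
        - Real.exp (τ * ξ.re) ≤ 0 := by
      intro τ hτ
      have hnorm : ‖z₀ * Complex.exp (τ * ξ)‖ = ‖z₀‖ * Real.exp (τ * ξ.re) := by
        rw [norm_mul, Complex.norm_exp]; simp
      have hlt' : Real.exp (τ * ξ.re) < 1 := by
        rw [← Real.exp_zero, Real.exp_lt_exp]
        exact mul_neg_of_pos_of_neg hτ hξ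
      have hlt2 : ‖z₀ * Complex.exp (τ * ξ)‖ < ‖z₀‖ := by
        rw [hnorm]; exact mul_lt_of_lt_one_right hn hlt'
      have h4 := schwarz _ hlt2.le (Or.inr hlt2)
      rw [hnorm, mul_div_cancel_left₀ _ hn.ne'] at h4
      have h5 := Complex.re_le_norm (f (z₀ * Complex.exp (τ * ξ)) / f z₀)
      rw [norm_div, h1, div_one] at h5
      linarith
    have hs := hre.tendsto_slope_zero_right
    have h0' := le_of_tendsto hs (b := 0) (by
      filter_upwards [self_mem_nhdsWithin] with τ hτ
      have h6 := hle τ hτ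
      simp only [zero_add, smul_eq_mul]
      have h7 : (f (z₀ * Complex.exp (((0 : ℝ) : ℂ) * ξ)) / f z₀).re
          - Real.exp (0 * ξ.re) = 0 := by simp [hf₀]
      rw [h7, sub_zero]
      exact mul_nonpos_of_nonneg_of_nonpos (inv_nonneg.2 (le_of_lt hτ)) h6)
    linarith
  have hre1 : 1 ≤ d.re := by
    have := key (-1) (by simp)
    simp at this
    linarith
  have him : d.im = 0 := by
    by_contra hne
    have := key ⟨-1, -d.re / d.im⟩ (by simp)
    simp only [Complex.mul_re] at this
    rw [div_mul_cancel₀ _ hne] at this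
    linarith
  refine ⟨d.re, hre1, ?_⟩
  have : ((d.re : ℝ) : ℂ) = d := Complex.ext (by simp) (by simp [him])
  rw [this, hdef, div_mul_cancel₀ _ hf₀]

/-- The cardioid domain `{2w + w² : |w| < 1}` is starlike with respect to the origin: dilating a
boundary point outwards never leads back into the domain. -/
theorem cardioid_starlike {ζ w : ℂ} {m s : ℝ} (hm : 1 ≤ m) (hs0 : 0 ≤ s) (hs1 : s ≤ 1)
    (hζ : ‖ζ‖ = 1) (hw : ‖w‖ < 1) : (m : ℂ) * (2 * ζ + ζ ^ 2) ≠ s * (2 * w + w ^ 2) := by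
  intro h
  set t := s / m with ht
  have hmpos : 0 < m := by linarith
  have ht0 : 0 ≤ t := by positivity
  have ht1 : t ≤ 1 := by rw [ht, div_le_one hmpos]; linarith
  have h' : 2 * ζ + ζ ^ 2 = (t : ℂ) * (2 * w + w ^ 2) := by
    have hmc : (m : ℂ) ≠ 0 := by exact_mod_cast hmpos.ne'
    rw [ht]
    push_cast
    field_simp
    linear_combination h
  obtain ⟨a, b⟩ := ζ
  obtain ⟨x, y⟩ := w
  have hζ2 : a ^ 2 + b ^ 2 = 1 := by
    have := congrArg (· ^ 2) hζ
    simp only [Complex.sq_norm, Complex.normSq_mk] at this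
    linarith
  have hw2 : x ^ 2 + y ^ 2 < 1 := by
    have : ‖(⟨x, y⟩ : ℂ)‖ ^ 2 < 1 := by
      have := norm_nonneg (⟨x, y⟩ : ℂ)
      nlinarith
    simp only [Complex.sq_norm, Complex.normSq_mk] at this
    linarith
  have hre := congrArg Complex.re h'
  have him := congrArg Complex.im h'
  simp [pow_two] at hre him
  clear_value t
  clear h h' hζ hw ht hm hmpos hs0 hs1
  -- real and imaginary parts of `2w + w²`, its squared modulus, and `|1 + w|²`
  obtain ⟨c, hc⟩ : ∃ c, c = 2 * x + (x * x - y * y) := ⟨_, rfl⟩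
  obtain ⟨e, he⟩ : ∃ e, e = 2 * y + (x * y + y * x) := ⟨_, rfl⟩
  obtain ⟨D, hD⟩ : ∃ D, D = c ^ 2 + e ^ 2 := ⟨_, rfl⟩
  obtain ⟨p, hp⟩ : ∃ p, p = (1 + x) ^ 2 + y ^ 2 := ⟨_, rfl⟩
  obtain ⟨q, hq⟩ : ∃ q, q = (1 + a) ^ 2 + b ^ 2 := ⟨_, rfl⟩
  rw [← hc] at hre
  rw [← he] at him
  have hp0 : 0 ≤ p := by rw [hp]; positivity
  have hq0 : 0 ≤ q := by rw [hq]; positivity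
  have hpD : p ^ 2 = D + 2 * c + 1 := by rw [hp, hD, hc, he]; ring
  have hqD : q ^ 2 = t ^ 2 * D + 2 * t * c + 1 := by
    have : q ^ 2 = (2 * a + (a * a - b * b)) ^ 2 + (2 * b + (a * b + b * a)) ^ 2
      + 2 * (2 * a + (a * a - b * b)) + 1 := by rw [hq]; ring
    rw [this, hre, him, hD]; ring
  have hp1 : D - 1 < 2 * p := by
    have hx : p < 2 * (1 + x) := by rw [hp]; nlinarith
    have hfac : p ^ 2 - 2 * p - 2 * c - 2 = (p - 2 * (1 + x)) * (p + 2 * (1 + x)) := by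
      rw [hp, hc]; ring
    have : (p - 2 * (1 + x)) * (p + 2 * (1 + x)) < 0 :=
      mul_neg_of_neg_of_pos (by linarith) (by linarith)
    linarith
  have hq1 : t ^ 2 * D - 1 = 2 * q := by
    have hx : q = 2 * (1 + a) := by rw [hq]; nlinarith
    have hfac : q ^ 2 - 2 * q - 2 * (t * c) - 2 = (q - 2 * (1 + a)) * (q + 2 * (1 + a)) := by
      rw [← hre, hq]; ring
    rw [sub_eq_zero.2 hx, zero_mul] at hfac
    linarith
  have htD : 1 ≤ t ^ 2 * D := by linarith
  have hD0 : 0 ≤ D := by rw [hD]; positivity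
  have htpos : 0 < t := lt_of_le_of_ne ht0 (by rintro rfl; norm_num at htD)
  have hD1 : 1 ≤ D := by nlinarith
  have hsq1 : (D - 1) ^ 2 < 4 * (D + 2 * c + 1) := by
    have := mul_self_lt_mul_self (by linarith) hp1
    linarith
  have hsq2 : (t ^ 2 * D - 1) ^ 2 = 4 * (t ^ 2 * D + 2 * t * c + 1) := by
    rw [← hqD, hq1]; ring
  clear hre him hp1 hq1 hp hq hc he hD hpD hqD hp0 hq0 hw2 hζ2
  have h3 : t * (D - 1) ^ 2 < t * (4 * (D + 2 * c + 1)) := mul_lt_mul_of_pos_left hsq1 htpos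
  have h4 : 0 < (1 - t) * (-(t * (1 + t + t ^ 2) * D ^ 2) + 6 * t * D - 3) := by linarith
  have h5 : 0 ≤ t * (1 + t + t ^ 2) * D ^ 2 - 6 * t * D + 3 := by
    nlinarith [mul_nonneg (mul_nonneg ht0 (sq_nonneg D)) (sq_nonneg (1 - t)), sq_nonneg (t * D - 1)]
  exact absurd h4 (not_lt.2 (mul_nonpos_of_nonneg_of_nonpos (by linarith) (by linarith)))

/-- The normalised primitive of `(phiC z - 1) / z`; it maps the disc onto a convex domain. -/
noncomputable def cardioidPrimitive (z : ℂ) : ℂ := (4 * z + z ^ 2) / 3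

/-- The branch of the inverse of `cardioidPrimitive` fixing the origin. -/
noncomputable def cardioidPrimitiveInv (v : ℂ) : ℂ := (4 + 3 * v) ^ (2⁻¹ : ℂ) - 2

theorem cardioidPrimitive_inv (v : ℂ) : cardioidPrimitive (cardioidPrimitiveInv v) = v := by
  have h : ((4 + 3 * v) ^ (2⁻¹ : ℂ)) ^ 2 = 4 + 3 * v := by
    simp
  rw [cardioidPrimitive, cardioidPrimitiveInv]
  linear_combination h / 3

theorem four_add_cardioidPrimitive (ζ : ℂ) : 4 + 3 * cardioidPrimitive ζ = (2 + ζ) ^ 2 := by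
  rw [cardioidPrimitive]; ring

theorem re_two_add_pos {ζ : ℂ} (h : ‖ζ‖ ≤ 1) : 0 < (2 + ζ).re := by
  have := neg_le_of_abs_le ((Complex.abs_re_le_norm ζ).trans h)
  simp
  linarith

theorem cardioidPrimitiveInv_apply {ζ : ℂ} (h : ‖ζ‖ ≤ 1) :
    cardioidPrimitiveInv (cardioidPrimitive ζ) = ζ := by
  rw [cardioidPrimitiveInv, four_add_cardioidPrimitive,
    Complex.sq_cpow_two_inv (re_two_add_pos h)]
  ring

theorem sq_mem_slitPlane {x : ℂ} (h : 0 < x.re) : x ^ 2 ∈ Complex.slitPlane := by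
  rw [Complex.mem_slitPlane_iff]
  simp only [pow_two, Complex.mul_re, Complex.mul_im]
  by_cases hi : x.im = 0
  · left; rw [hi]; nlinarith
  · right
    have := mul_ne_zero h.ne' hi
    intro h'
    apply this
    linarith

theorem four_add_mem_slitPlane {ζ v : ℂ} (h : ‖ζ‖ ≤ 1) (hv : cardioidPrimitive ζ = v) :
    4 + 3 * v ∈ Complex.slitPlane := by
  rw [← hv, four_add_cardioidPrimitive]
  exact sq_mem_slitPlane (re_two_add_pos h)

theorem differentiableAt_cardioidPrimitiveInv {v : ℂ} (h : 4 + 3 * v ∈ Complex.slitPlane) :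
    DifferentiableAt ℂ cardioidPrimitiveInv v := by
  unfold cardioidPrimitiveInv
  have h1 : DifferentiableAt ℂ (fun v : ℂ => 4 + 3 * v) v := by fun_prop
  exact (h1.cpow (differentiableAt_const _) h).sub_const 2

theorem isOpen_setOf_norm_cardioidPrimitiveInv_lt :
    IsOpen {v : ℂ | ‖cardioidPrimitiveInv v‖ < 1} := by
  rw [isOpen_iff_mem_nhds]
  intro v hv
  have hc := (differentiableAt_cardioidPrimitiveInv
    (four_add_mem_slitPlane (le_of_lt hv) (cardioidPrimitive_inv v))).continuousAt.norm
  exact hc (Iio_mem_nhds hv)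

/-- If `z P'(z)` takes values in a contraction of the cardioid domain `(2/3)(2w + w²)`, `|w| < 1`,
then `P` is subordinate to the normalised primitive. -/
theorem exists_cardioidPrimitive_eq {P w : ℂ → ℂ} {s : ℝ} (hs0 : 0 ≤ s) (hs1 : s ≤ 1)
    (hP : DifferentiableOn ℂ P (Metric.ball 0 1)) (hP0 : P 0 = 0)
    (hw : ∀ z, ‖z‖ < 1 → ‖w z‖ < 1)
    (hPw : ∀ z, ‖z‖ < 1 → z * deriv P z = s * (2 / 3 * (2 * w z + w z ^ 2)))
    {z : ℂ} (hz : ‖z‖ < 1) : ∃ ω : ℂ, ‖ω‖ < 1 ∧ P z = cardioidPrimitive ω := by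
  by_contra hne
  have hbad : ∃ z, ‖z‖ < 1 ∧ ¬ ‖cardioidPrimitiveInv (P z)‖ < 1 :=
    ⟨z, hz, fun h => hne ⟨_, h, (cardioidPrimitive_inv _).symm⟩⟩
  clear hne hz z
  obtain ⟨z₁, hz₁, hb₁⟩ := hbad
  have hdiff : ∀ z, ‖z‖ < 1 → DifferentiableAt ℂ P z := fun z hz =>
    hP.differentiableAt (Metric.isOpen_ball.mem_nhds (by simpa using hz))
  set good := {v : ℂ | ‖cardioidPrimitiveInv v‖ < 1} with hgood
  have hK : IsCompact (Metric.closedBall (0 : ℂ) ‖z₁‖ ∩ P ⁻¹' goodᶜ) := by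
    refine (isCompact_closedBall _ _).of_isClosed_subset ?_ Set.inter_subset_left
    refine ContinuousOn.preimage_isClosed_of_isClosed ?_ Metric.isClosed_closedBall
      isOpen_setOf_norm_cardioidPrimitiveInv_lt.isClosed_compl
    intro y hy
    have hy' : ‖y‖ ≤ ‖z₁‖ := by simpa using hy
    exact (hdiff y (hy'.trans_lt hz₁)).continuousAt.continuousWithinAt
  obtain ⟨z₀, ⟨hz₀m, hz₀b⟩, hmin⟩ := hK.exists_isMinOn ⟨z₁, by simp, hb₁⟩
    continuous_norm.continuousOn
  have hz₀le : ‖z₀‖ ≤ ‖z₁‖ := by simpa using hz₀m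
  have hz₀ : ‖z₀‖ < 1 := hz₀le.trans_lt hz₁
  have hin : ∀ z, ‖z‖ < ‖z₀‖ → ‖cardioidPrimitiveInv (P z)‖ < 1 := by
    intro z hz
    by_contra h
    have := hmin ⟨by simpa using (hz.le.trans hz₀le), h⟩
    exact absurd hz (not_lt.2 this)
  have hz₀ne : z₀ ≠ 0 := by
    rintro rfl
    apply hz₀b
    have : cardioidPrimitiveInv (P 0) = 0 := by
      rw [hP0]
      simpa [cardioidPrimitive] using cardioidPrimitiveInv_apply (ζ := 0) (by simp)
    rw [hgood, Set.mem_ofPred_eq, this]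
    simp
  obtain ⟨ζ, hζle, hζ⟩ : P z₀ ∈ cardioidPrimitive '' Metric.closedBall 0 1 := by
    have hcl : IsClosed (cardioidPrimitive '' Metric.closedBall 0 1) := by
      refine ((isCompact_closedBall _ _).image ?_).isClosed
      unfold cardioidPrimitive
      fun_prop
    have hmem : z₀ ∈ closure (Metric.ball (0 : ℂ) ‖z₀‖) := by
      rw [closure_ball _ (norm_ne_zero_iff.2 hz₀ne)]
      simp
    refine closure_minimal ?_ hcl (((hdiff z₀ hz₀).continuousAt.continuousWithinAt
      (s := Metric.ball (0 : ℂ) ‖z₀‖)).mem_closure_image hmem)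
    rintro _ ⟨z, hz, rfl⟩
    have hz' : ‖z‖ < ‖z₀‖ := by simpa using hz
    exact ⟨_, by simpa using (hin z hz').le, cardioidPrimitive_inv _⟩
  have hζle' : ‖ζ‖ ≤ 1 := by simpa using hζle
  have hfz₀ : cardioidPrimitiveInv (P z₀) = ζ := by
    rw [← hζ, cardioidPrimitiveInv_apply hζle']
  have hζ1 : ‖ζ‖ = 1 := le_antisymm hζle' (by
    have : ¬ ‖cardioidPrimitiveInv (P z₀)‖ < 1 := hz₀b
    rw [hfz₀] at this
    exact not_lt.1 this)
  have hfd : DifferentiableAt ℂ (fun z => cardioidPrimitiveInv (P z)) z₀ :=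
    (differentiableAt_cardioidPrimitiveInv (four_add_mem_slitPlane hζle' hζ)).comp z₀
      (hdiff z₀ hz₀)
  obtain ⟨m, hm, hmd⟩ := exists_mul_deriv_eq_of_norm_eq_one
    (f := fun z => cardioidPrimitiveInv (P z)) (z₀ := z₀) (fun z hz => by
      have hz' : ‖z‖ < ‖z₀‖ := by simpa using hz
      exact ((differentiableAt_cardioidPrimitiveInv (four_add_mem_slitPlane (hin z hz').le
        (cardioidPrimitive_inv _))).comp z (hdiff z (hz'.trans hz₀))).differentiableWithinAt)
    hfd (by
      rw [hP0]
      simpa [cardioidPrimitive] using cardioidPrimitiveInv_apply (ζ := 0) (by simp))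
    hin (by rw [hfz₀, hζ1])
  have hPd : deriv P z₀ = (4 + 2 * ζ) / 3 * deriv (fun z => cardioidPrimitiveInv (P z)) z₀ := by
    have h1 : HasDerivAt cardioidPrimitive ((4 + 2 * ζ) / 3) (cardioidPrimitiveInv (P z₀)) := by
      rw [hfz₀]
      unfold cardioidPrimitive
      have := (((hasDerivAt_id ζ).const_mul 4).add ((hasDerivAt_id ζ).pow 2)).div_const 3
      simpa using this
    have h2 := h1.comp z₀ hfd.hasDerivAt
    have h3 : (cardioidPrimitive ∘ fun z => cardioidPrimitiveInv (P z)) = P :=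
      funext fun z => cardioidPrimitive_inv _
    rw [h3] at h2
    exact h2.deriv
  refine cardioid_starlike hm hs0 hs1 hζ1 (hw z₀ hz₀) ?_
  have := hPw z₀ hz₀
  rw [hPd] at this
  rw [hfz₀] at hmd
  linear_combination 3 / 2 * this - (2 + ζ) * hmd

theorem Real.cos_le_exp_neg_sq_div_two {x : ℝ} (h0 : 0 ≤ x) (h1 : x < Real.pi / 2) :
    Real.cos x ≤ Real.exp (-(x ^ 2 / 2)) := by
  have hd : ∀ y : ℝ, HasDerivAt (fun y => Real.exp (y ^ 2 / 2) * Real.cos y)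
      (Real.exp (y ^ 2 / 2) * (y * Real.cos y - Real.sin y)) y := by
    intro y
    have h2 := ((((hasDerivAt_id y).pow 2).div_const 2).exp).mul (Real.hasDerivAt_cos y)
    refine h2.congr_deriv ?_
    simp
    ring
  have hanti : AntitoneOn (fun y => Real.exp (y ^ 2 / 2) * Real.cos y)
      (Set.Ico 0 (Real.pi / 2)) := by
    refine antitoneOn_of_deriv_nonpos (convex_Ico _ _)
      (fun y _ => (hd y).continuousAt.continuousWithinAt)
      (fun y _ => (hd y).differentiableAt.differentiableWithinAt) (fun y hy => ?_)
    rw [interior_Ico] at hy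
    rw [(hd y).deriv]
    refine mul_nonpos_of_nonneg_of_nonpos (Real.exp_pos _).le ?_
    have hcos : 0 < Real.cos y := Real.cos_pos_of_mem_Ioo ⟨by linarith [hy.1], hy.2⟩
    have := Real.lt_tan hy.1 hy.2
    rw [Real.tan_eq_sin_div_cos, lt_div_iff₀ hcos] at this
    linarith
  have := hanti ⟨le_rfl, by linarith⟩ ⟨h0, h1⟩ h0
  simp only [ne_eq, OfNat.ofNat_ne_zero, not_false_eq_true, zero_pow, zero_div, Real.exp_zero,
    Real.cos_zero, mul_one] at this
  rw [Real.exp_neg, ← one_div, le_div_iff₀ (Real.exp_pos _)]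
  linarith

theorem Complex.arg_sq_le {v : ℂ} (hv : 0 < v.re) :
    v.arg ^ 2 ≤ 2 * (Real.log ‖v‖ - Real.log v.re) := by
  have hv0 : v ≠ 0 := fun h => by simp [h] at hv
  have hn : 0 < ‖v‖ := norm_pos_iff.2 hv0
  have harg : |v.arg| < Real.pi / 2 := Complex.abs_arg_lt_pi_div_two_iff.2 (Or.inl hv)
  have h := Real.cos_le_exp_neg_sq_div_two (abs_nonneg _) harg
  rw [Real.cos_abs, Complex.cos_arg hv0, sq_abs, ← Real.log_le_iff_le_exp (by positivity),
    Real.log_div hv.ne' hn.ne'] at h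
  linarith

/-- The norm of `Complex.log u`, controlled through the modulus and the real part of `u`. -/
theorem Complex.norm_log_sq_le {u : ℂ} (hu : 0 < u.re) :
    ‖Complex.log u‖ ^ 2 ≤ 1 + (1 + Real.log ‖u‖) ^ 2 - 2 * (1 + Real.log u.re) := by
  have h := Complex.arg_sq_le hu
  rw [Complex.sq_norm, Complex.normSq_apply, Complex.log_re, Complex.log_im]
  linarith

theorem Real.exp_le_of_le_one {x : ℝ} (h0 : 0 ≤ x) (h1 : x ≤ 1) :
    Real.exp x ≤ 1 + x + x ^ 2 / 2 + 2 / 9 * x ^ 3 := by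
  have := Real.exp_bound' h0 h1 (n := 3) (by norm_num)
  norm_num [Finset.sum_range_succ, Nat.factorial] at this
  linarith

theorem Real.sum_four_le_exp {x : ℝ} (h0 : 0 ≤ x) :
    1 + x + x ^ 2 / 2 + x ^ 3 / 6 + x ^ 4 / 24 ≤ Real.exp x := by
  have := Real.sum_le_exp_of_nonneg h0 5
  norm_num [Finset.sum_range_succ, Nat.factorial] at this
  linarith

theorem Real.sum_six_le_exp {x : ℝ} (h0 : 0 ≤ x) :
    1 + x + x ^ 2 / 2 + x ^ 3 / 6 + x ^ 4 / 24 + x ^ 5 / 120 + x ^ 6 / 720 ≤ Real.exp x := by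
  have := Real.sum_le_exp_of_nonneg h0 7
  norm_num [Finset.sum_range_succ, Nat.factorial] at this
  linarith

/-- The boundary of `1 + (1 - e⁻¹) cardioidPrimitive` stays in `exp` of the closed disc; the
parameter `a` approximates `2(e - 1)/3` and `d = 1 + Re z`. -/
theorem half_log_quadratic_sq_le {a d : ℝ} (ha0 : 1.1455 ≤ a) (ha1 : a ≤ 1.1456) (hd0 : 0 ≤ d)
    (hd2 : d ≤ 2) :
    (1 / 2 * Real.log (1 + 2 * a ^ 2 * d + (2 * a + 3 * a ^ 2) * d ^ 2)) ^ 2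
      ≤ 2 * Real.log (1 + a * d ^ 2) := by
  obtain ⟨N, hN⟩ : ∃ N, N = 1 + 2 * a ^ 2 * d + (2 * a + 3 * a ^ 2) * d ^ 2 := ⟨_, rfl⟩
  obtain ⟨g, hg⟩ : ∃ g, g = Real.log (1 + a * d ^ 2) := ⟨_, rfl⟩
  rw [← hN, ← hg]
  have had : 0 ≤ a * d ^ 2 := by positivity
  have hN1 : 1 ≤ N := by
    rw [hN]
    have : 0 ≤ 2 * a ^ 2 * d := by positivity
    have : 0 ≤ (2 * a + 3 * a ^ 2) * d ^ 2 := by positivity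
    linarith
  have hg0 : 0 ≤ g := by rw [hg]; exact Real.log_nonneg (by linarith)
  have hexp : Real.exp g = 1 + a * d ^ 2 := by rw [hg, Real.exp_log (by linarith)]
  have hlN0 : 0 ≤ Real.log N := Real.log_nonneg hN1
  rcases le_total g 0.8 with hg8 | hg8
  · set s := √(2 * g) with hs
    have hs2 : s ^ 2 = 2 * g := Real.sq_sqrt (by linarith)
    have hs0 : 0 ≤ s := Real.sqrt_nonneg _
    have hsT : s ≤ 1.27 := by
      by_contra h
      nlinarith
    suffices h : Real.log N ≤ 2 * s by
      rw [← hs2]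
      exact pow_le_pow_left₀ (by linarith) (by linarith) 2
    rw [Real.log_le_iff_le_exp (by linarith)]
    have hg' : g = s ^ 2 / 2 := by linarith
    have hE : a * d ^ 2 ≤ s ^ 2 / 2 * (1 + s ^ 2 / 4 + s ^ 4 / 18) := by
      have := Real.exp_le_of_le_one hg0 (by linarith)
      rw [hexp, hg'] at this
      linarith
    have hdle : d ≤ 0.661 * s * (1 + s ^ 2 / 8 + s ^ 4 / 36) := by
      refine abs_le_of_sq_le_sq' ?_ (by positivity) |>.2
      have h1 : a * d ^ 2 ≤ a * (0.661 * s * (1 + s ^ 2 / 8 + s ^ 4 / 36)) ^ 2 := by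
        calc a * d ^ 2 ≤ s ^ 2 / 2 * (1 + s ^ 2 / 4 + s ^ 4 / 18) := hE
          _ ≤ s ^ 2 / 2 * (1 + s ^ 2 / 8 + s ^ 4 / 36) ^ 2 := by
              gcongr
              have : 0 ≤ (s ^ 2 / 8 + s ^ 4 / 36) ^ 2 := by positivity
              linarith
          _ = 1 / 2 * (s * (1 + s ^ 2 / 8 + s ^ 4 / 36)) ^ 2 := by ring
          _ ≤ (a * 0.661 ^ 2) * (s * (1 + s ^ 2 / 8 + s ^ 4 / 36)) ^ 2 := by
              gcongr
              linarith
          _ = _ := by ring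
      exact le_of_mul_le_mul_left h1 (by linarith)
    have ha2 : 2 * a ^ 2 ≤ 2.6249 := by nlinarith
    have hNle : N ≤ 1 + 2.6249 * (0.661 * s * (1 + s ^ 2 / 8 + s ^ 4 / 36))
        + 5.4368 * (s ^ 2 / 2 * (1 + s ^ 2 / 4 + s ^ 4 / 18)) := by
      have h1 : 2 * a ^ 2 * d ≤ 2.6249 * (0.661 * s * (1 + s ^ 2 / 8 + s ^ 4 / 36)) := by
        gcongr
      have h2 : (2 + 3 * a) * (a * d ^ 2)
          ≤ 5.4368 * (s ^ 2 / 2 * (1 + s ^ 2 / 4 + s ^ 4 / 18)) := by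
        gcongr
        linarith
      rw [hN]
      linarith
    refine (hNle.trans ?_).trans (Real.sum_four_le_exp (by linarith : 0 ≤ 2 * s))
    have hT : 0 ≤ 1.27 - s := by linarith
    have b0 : 0 ≤ s * (1.27 - s) ^ 5 := by positivity
    have b1 : 0 ≤ s * (s * (1.27 - s) ^ 4) := by positivity
    have b2 : 0 ≤ s * (s ^ 2 * (1.27 - s) ^ 3) := by positivity
    have b3 : 0 ≤ s * (s ^ 3 * (1.27 - s) ^ 2) := by positivity
    have b4 : 0 ≤ s * (s ^ 4 * (1.27 - s)) := by positivity
    have b5 : 0 ≤ s * s ^ 5 := by positivity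
    linarith
  · have hN5 : N ≤ 5.6 * Real.exp g := by
      have c1 : 2 * a ^ 2 ≤ 2.6249 := by nlinarith
      have c2 : a * (3 * a - 3.6) ≤ -0.1869 := by nlinarith
      have c3 := mul_le_mul_of_nonneg_right c1 hd0
      have c4 := mul_le_mul_of_nonneg_right c2 (sq_nonneg d)
      rw [hN, hexp]
      nlinarith [mul_nonneg hd0 (sub_nonneg.2 hd2)]
    have h56 : Real.log 5.6 ≤ 1.727 := by
      rw [Real.log_le_iff_le_exp (by norm_num)]
      refine le_trans ?_ (Real.sum_six_le_exp (by norm_num))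
      norm_num
    have hl : Real.log N ≤ 1.727 + g := by
      calc Real.log N ≤ Real.log (5.6 * Real.exp g) := Real.log_le_log (by linarith) hN5
        _ = Real.log 5.6 + g := by
          rw [Real.log_mul (by norm_num) (Real.exp_pos _).ne', Real.log_exp]
        _ ≤ _ := by linarith
    have hg2 : g ≤ 2 := by
      rw [hg, Real.log_le_iff_le_exp (by linarith)]
      refine le_trans ?_ (Real.sum_four_le_exp (by norm_num))
      nlinarith
    have : (1 / 2 * Real.log N) ^ 2 ≤ (1 / 2 * (1.727 + g)) ^ 2 :=
      pow_le_pow_left₀ (by linarith) (by linarith) 2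
    nlinarith

theorem half_log_sq_lt_two_log {r : ℝ} (h1 : 1 < r) (h2 : r ≤ 2.311) :
    (1 / 2 * Real.log (r ^ 2 + 2 * Real.exp 1 * (r - 1))) ^ 2 < 2 * Real.log r := by
  have he := Real.exp_one_lt_d9
  have he0 := Real.exp_one_gt_d9
  set s := √(2 * Real.log r) with hs
  have hlog : 0 < Real.log r := Real.log_pos h1
  have hs2 : s ^ 2 = 2 * Real.log r := Real.sq_sqrt (by linarith)
  have hs0 : 0 < s := Real.sqrt_pos.2 (by linarith)
  have hlr : Real.log r ≤ 0.845 := by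
    rw [Real.log_le_iff_le_exp (by linarith)]
    refine le_trans ?_ (Real.sum_four_le_exp (by norm_num))
    norm_num
    linarith
  have hsT : s ≤ 1.3 := by
    by_contra h
    nlinarith
  have hr : r = Real.exp (s ^ 2 / 2) := by
    rw [hs2, mul_div_cancel_left₀ _ two_ne_zero, Real.exp_log (by linarith)]
  have hE : r ≤ 1 + s ^ 2 / 2 * (1 + s ^ 2 / 4 + s ^ 4 / 18) := by
    have := Real.exp_le_of_le_one (x := s ^ 2 / 2) (by positivity) (by linarith)
    rw [← hr] at this
    linarith
  rw [← hs2]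
  have hN1 : 1 ≤ r ^ 2 + 2 * Real.exp 1 * (r - 1) := by nlinarith
  have hl0 := Real.log_nonneg hN1
  suffices h : Real.log (r ^ 2 + 2 * Real.exp 1 * (r - 1)) < 2 * s from
    pow_lt_pow_left₀ (by linarith) (by linarith) two_ne_zero
  rw [Real.log_lt_iff_lt_exp (by linarith)]
  refine lt_of_lt_of_le ?_ (Real.sum_six_le_exp (by linarith : 0 ≤ 2 * s))
  have hle : r ^ 2 + 2 * Real.exp 1 * (r - 1)
      ≤ (1 + s ^ 2 / 2 * (1 + s ^ 2 / 4 + s ^ 4 / 18)) ^ 2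
        + 5.4366 * (s ^ 2 / 2 * (1 + s ^ 2 / 4 + s ^ 4 / 18)) := by
    have h3 : 2 * Real.exp 1 * (r - 1)
        ≤ 5.4366 * (s ^ 2 / 2 * (1 + s ^ 2 / 4 + s ^ 4 / 18)) :=
      mul_le_mul (by linarith) (by linarith) (by linarith) (by norm_num)
    have h4 := pow_le_pow_left₀ (by linarith) hE 2
    linarith
  refine hle.trans_lt ?_
  have hT : 0 ≤ 1.32 - s := by linarith
  have b0 : 0 < s * (1.32 - s) ^ 11 := by
    have : 0 < 1.32 - s := by linarith
    positivity
  have b1 : 0 ≤ s * (s * (1.32 - s) ^ 10) := by positivity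
  have b2 : 0 ≤ s * (s ^ 2 * (1.32 - s) ^ 9) := by positivity
  have b3 : 0 ≤ s * (s ^ 3 * (1.32 - s) ^ 8) := by positivity
  have b4 : 0 ≤ s * (s ^ 4 * (1.32 - s) ^ 7) := by positivity
  have b5 : 0 ≤ s * (s ^ 5 * (1.32 - s) ^ 6) := by positivity
  have b6 : 0 ≤ s * (s ^ 6 * (1.32 - s) ^ 5) := by positivity
  have b7 : 0 ≤ s * (s ^ 7 * (1.32 - s) ^ 4) := by positivity
  have b8 : 0 ≤ s * (s ^ 8 * (1.32 - s) ^ 3) := by positivity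
  have b9 : 0 ≤ s * (s ^ 9 * (1.32 - s) ^ 2) := by positivity
  have b10 : 0 ≤ s * (s ^ 10 * (1.32 - s)) := by positivity
  have b11 : 0 ≤ s * s ^ 11 := by positivity
  linarith

theorem one_add_half_log_sq_lt {R B : ℝ} (h1 : 0.85 ≤ R) (h2 : R ≤ 1.6) (hB0 : 0 ≤ B)
    (hB1 : B ≤ 1) :
    (1 + 1 / 2 * Real.log (R ^ 2 + B)) ^ 2 < 2 * (1 + Real.log R) := by
  have hR : 0 < R := by linarith
  set t := Real.log R with ht
  have hRt : R = Real.exp t := by rw [ht, Real.exp_log hR]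
  have ht0 : -0.1765 ≤ t := by
    have h3 := Real.one_sub_inv_le_log_of_pos hR
    have h4 : R⁻¹ ≤ 1.1765 := by
      rw [inv_le_comm₀ hR (by norm_num)]
      refine le_trans ?_ h1
      norm_num
    linarith
  have ht1 : t ≤ 0.6 := by
    have := Real.log_le_sub_one_of_pos hR
    linarith
  have hpos : 0 < R ^ 2 + B := by positivity
  have hlow : 0 ≤ 1 + 1 / 2 * Real.log (R ^ 2 + B) := by
    have h3 := Real.one_sub_inv_le_log_of_pos hpos
    have h4 : (R ^ 2 + B)⁻¹ ≤ 2 := by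
      rw [inv_le_comm₀ hpos (by norm_num)]
      nlinarith
    linarith
  have hup : Real.log (R ^ 2 + B) ≤ t + Real.log 2 + t ^ 2 / 2 := by
    rw [Real.log_le_iff_le_exp hpos, Real.exp_add, Real.exp_add, Real.exp_log two_pos]
    have hc := Real.cosh_le_exp_half_sq t
    rw [Real.cosh_eq] at hc
    have h3 : R ^ 2 + 1 = Real.exp t * 2 * ((Real.exp t + Real.exp (-t)) / 2) := by
      rw [hRt, Real.exp_neg]
      field_simp
    calc R ^ 2 + B ≤ R ^ 2 + 1 := by linarith
      _ ≤ _ := by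
        rw [h3]
        gcongr
  have hl2 := Real.log_two_lt_d9
  have h5 : 1 + 1 / 2 * Real.log (R ^ 2 + B) ≤ 1.3731 + 0.606 * t + 0.001 := by nlinarith
  have h6 := pow_le_pow_left₀ hlow h5 2
  nlinarith

/-- Along the unit circle, `1 + (1 - e⁻¹) cardioidPrimitive` has a logarithm of norm at most one. -/
theorem norm_log_one_add_le_of_norm_eq_one {z : ℂ} (hz : ‖z‖ = 1) :
    ‖Complex.log (1 + (1 - Real.exp (-1) : ℝ) * cardioidPrimitive z)‖ ≤ 1 := by
  obtain ⟨x, y⟩ := z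
  have hxy : x ^ 2 + y ^ 2 = 1 := by
    have := congrArg (· ^ 2) hz
    simp only [Complex.sq_norm, Complex.normSq_mk] at this
    linarith
  obtain ⟨E, hE⟩ : ∃ E, E = Real.exp 1 := ⟨_, rfl⟩
  have hE0 : 2.7182818283 < E := hE ▸ Real.exp_one_gt_d9
  have hE1 : E < 2.7182818286 := hE ▸ Real.exp_one_lt_d9
  have hEpos : 0 < E := by linarith
  obtain ⟨a, ha⟩ : ∃ a, a = 2 * (E - 1) / 3 := ⟨_, rfl⟩
  obtain ⟨u, hu⟩ : ∃ u, u = 1 + (1 - Real.exp (-1) : ℝ) * cardioidPrimitive ⟨x, y⟩ := ⟨_, rfl⟩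
  rw [← hu]
  have hc : 1 - Real.exp (-1) = 3 * a / (2 * E) := by
    rw [Real.exp_neg, ← hE, ha]
    field_simp
  have hcH : cardioidPrimitive ⟨x, y⟩ = ⟨(4 * x + (x * x - y * y)) / 3, (4 * y + 2 * x * y) / 3⟩ := by
    apply Complex.ext <;> simp [cardioidPrimitive, pow_two]
    ring
  have hre : u.re = 1 + 3 * a / (2 * E) * ((4 * x + (x * x - y * y)) / 3) := by
    rw [hu, hc, hcH, Complex.add_re, Complex.re_ofReal_mul, Complex.one_re]
  have him : u.im = 3 * a / (2 * E) * ((4 * y + 2 * x * y) / 3) := by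
    rw [hu, hc, hcH, Complex.add_im, Complex.im_ofReal_mul, Complex.one_im, zero_add]
  obtain ⟨d, hd⟩ : ∃ d, d = 1 + x := ⟨_, rfl⟩
  have hd0 : 0 ≤ d := by rw [hd]; nlinarith
  have hd2 : d ≤ 2 := by rw [hd]; nlinarith
  have ha0 : 1.1455 ≤ a := by rw [ha]; norm_num; linarith
  have ha1 : a ≤ 1.1456 := by rw [ha]; norm_num; linarith
  have hx : x = d - 1 := by linarith
  have hy : y ^ 2 = 1 - (d - 1) ^ 2 := by rw [← hx]; linarith
  have hEa : E = 3 / 2 * a + 1 := by rw [ha]; ring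
  have hreE : E * u.re = 1 + a * d ^ 2 := by
    rw [hre]
    field_simp
    rw [hy, hx, hEa]
    ring
  have himE : E * u.im = a * y * (1 + d) := by
    rw [him, hx]
    field_simp
    ring
  have hrepos : 0 < u.re := by
    have : 0 < E * u.re := by rw [hreE]; positivity
    exact pos_of_mul_pos_right this hEpos.le
  have hnorm : E ^ 2 * ‖u‖ ^ 2 = 1 + 2 * a ^ 2 * d + (2 * a + 3 * a ^ 2) * d ^ 2 := by
    rw [Complex.sq_norm, Complex.normSq_apply]
    have : E ^ 2 * (u.re * u.re + u.im * u.im) = (E * u.re) ^ 2 + (E * u.im) ^ 2 := by ring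
    rw [this, hreE, himE, mul_pow, mul_pow, hy]
    ring
  have hnpos : 0 < ‖u‖ := norm_pos_iff.2 fun h => by simp [h] at hrepos
  have hlE : Real.log E = 1 := by rw [hE, Real.log_exp]
  have h1 : 1 + Real.log u.re = Real.log (1 + a * d ^ 2) := by
    rw [← hreE, Real.log_mul hEpos.ne' hrepos.ne', hlE]
  have h2 : 1 + Real.log ‖u‖
      = 1 / 2 * Real.log (1 + 2 * a ^ 2 * d + (2 * a + 3 * a ^ 2) * d ^ 2) := by
    rw [← hnorm, ← mul_pow, Real.log_pow, Real.log_mul hEpos.ne' hnpos.ne', hlE]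
    push_cast
    ring
  have h3 := half_log_quadratic_sq_le ha0 ha1 hd0 hd2
  have h4 := Complex.norm_log_sq_le hrepos
  rw [h1, h2] at h4
  have : ‖Complex.log u‖ ^ 2 ≤ 1 ^ 2 := by linarith
  exact (abs_le_of_sq_le_sq' this zero_le_one).2

theorem neg_one_le_re_cardioidPrimitive {z : ℂ} (hz : ‖z‖ ≤ 1) :
    -1 ≤ (cardioidPrimitive z).re := by
  obtain ⟨x, y⟩ := z
  have hxy : x ^ 2 + y ^ 2 ≤ 1 := by
    have : ‖(⟨x, y⟩ : ℂ)‖ ^ 2 ≤ 1 := pow_le_one₀ (norm_nonneg _) hz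
    simp only [Complex.sq_norm, Complex.normSq_mk] at this
    linarith
  have : (cardioidPrimitive ⟨x, y⟩).re = (4 * x + (x * x - y * y)) / 3 := by
    simp [cardioidPrimitive, pow_two]
  rw [this]
  nlinarith [sq_nonneg (1 + x)]

theorem neg_one_lt_re_cardioidPrimitive {z : ℂ} (hz : ‖z‖ < 1) :
    -1 < (cardioidPrimitive z).re := by
  obtain ⟨x, y⟩ := z
  have hxy : x ^ 2 + y ^ 2 < 1 := by
    have : ‖(⟨x, y⟩ : ℂ)‖ ^ 2 < 1 := pow_lt_one₀ (norm_nonneg _) hz two_ne_zero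
    simp only [Complex.sq_norm, Complex.normSq_mk] at this
    linarith
  have : (cardioidPrimitive ⟨x, y⟩).re = (4 * x + (x * x - y * y)) / 3 := by
    simp [cardioidPrimitive, pow_two]
  rw [this]
  nlinarith [sq_nonneg (1 + x)]

theorem norm_cardioidPrimitive_lt {z : ℂ} (hz : ‖z‖ < 1) : ‖cardioidPrimitive z‖ < 5 / 3 := by
  rw [cardioidPrimitive, norm_div]
  have h1 := norm_add_le (4 * z) (z ^ 2)
  rw [norm_mul, norm_pow] at h1
  norm_num at h1 ⊢
  nlinarith [norm_nonneg z]

theorem norm_log_one_add_lt_one {z : ℂ} (hz : ‖z‖ < 1) :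
    ‖Complex.log (1 + (1 - Real.exp (-1) : ℝ) * cardioidPrimitive z)‖ < 1 := by
  set c : ℝ := 1 - Real.exp (-1) with hc
  have hc0 : 0 ≤ c := by
    have := Real.exp_le_one_iff.2 (by norm_num : (-1 : ℝ) ≤ 0)
    linarith
  have hc1 : c < 1 := by
    have := Real.exp_pos (-1)
    linarith
  set F : ℂ → ℂ := fun z => Complex.log (1 + (c : ℂ) * cardioidPrimitive z) with hF
  have hslit : ∀ z : ℂ, ‖z‖ ≤ 1 → 1 + (c : ℂ) * cardioidPrimitive z ∈ Complex.slitPlane := by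
    intro z hz
    left
    rw [Complex.add_re, Complex.re_ofReal_mul, Complex.one_re]
    nlinarith [neg_one_le_re_cardioidPrimitive hz]
  have hdiff : ∀ z : ℂ, ‖z‖ ≤ 1 → DifferentiableAt ℂ F z := by
    intro z hz
    refine DifferentiableAt.clog ?_ (hslit z hz)
    unfold cardioidPrimitive
    fun_prop
  have hle : ∀ z : ℂ, ‖z‖ < 1 → ‖F z‖ ≤ 1 := by
    intro z hz
    refine Complex.norm_le_of_forall_mem_frontier_norm_le (U := Metric.ball 0 1)
      Metric.isBounded_ball ?_ ?_ (subset_closure (by simpa using hz))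
    · refine DifferentiableOn.diffContOnCl fun y hy => ?_
      rw [closure_ball _ one_ne_zero] at hy
      exact (hdiff y (by simpa using hy)).differentiableWithinAt
    · intro y hy
      rw [frontier_ball _ one_ne_zero] at hy
      exact norm_log_one_add_le_of_norm_eq_one (by simpa using hy)
  have := Complex.norm_le_norm_of_mapsTo_ball (f := F) (R := 1)
    (fun y hy => (hdiff y (by simpa using (le_of_lt (by simpa using hy : ‖y‖ < 1)))).differentiableWithinAt)
    (fun y hy => by simpa using hle y (by simpa using hy))
    (by simp [hF, cardioidPrimitive]) hz
  exact this.trans_lt hz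

/-- The case of two nested logarithms needs only a half-plane and a bound on the modulus. -/
theorem norm_log_one_add_log_one_add_lt_one {u : ℂ}
    (hre : Real.exp (Real.exp (-1) - 1) - 1 < u.re) (hn : ‖u‖ ≤ 0.79) :
    ‖Complex.log (1 + Complex.log (1 + u))‖ < 1 := by
  have he := Real.exp_one_lt_d9
  have he0 := Real.exp_one_gt_d9
  have heinv : Real.exp 1 * Real.exp (-1) = 1 := by rw [← Real.exp_add]; simp
  have hinvpos := Real.exp_pos (-1)
  obtain ⟨v, hv⟩ : ∃ v, v = 1 + u := ⟨_, rfl⟩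
  rw [← hv]
  have hvre : v.re = 1 + u.re := by rw [hv]; simp
  have hX : Real.exp (Real.exp (-1) - 1) < v.re := by linarith
  have hX0 : 0 < v.re := (Real.exp_pos _).trans hX
  have hlX : Real.exp (-1) - 1 < Real.log v.re := by rwa [Real.lt_log_iff_exp_lt hX0]
  have hv0 : 0 < ‖v‖ := norm_pos_iff.2 fun h => by simp [h] at hX0
  have hlv : Real.log v.re ≤ Real.log ‖v‖ := Real.log_le_log hX0 (Complex.re_le_norm v)
  have hA := Complex.arg_sq_le hX0
  have hA1 : v.arg ^ 2 ≤ 1 := by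
    have h1 : ‖v‖ ^ 2 ≤ Real.exp 1 * v.re ^ 2 := by
      have h2 : ‖u‖ ^ 2 ≤ 0.6241 := by
        have := pow_le_pow_left₀ (norm_nonneg u) hn 2
        norm_num at this ⊢
        exact this
      rw [Complex.sq_norm, Complex.normSq_apply] at h2 ⊢
      have : v.im = u.im := by rw [hv]; simp
      rw [this]
      have h3 : 2.718 * v.re ^ 2 ≤ Real.exp 1 * v.re ^ 2 := by gcongr; linarith
      refine le_trans ?_ h3
      rw [hvre]
      nlinarith [sq_nonneg (2.718 * (1 + u.re) - 1)]
    have h4 := Real.log_le_log (by positivity) h1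
    rw [Real.log_mul (Real.exp_pos _).ne' (by positivity), Real.log_exp, Real.log_pow,
      Real.log_pow] at h4
    push_cast at h4
    linarith
  have hv179 : ‖v‖ ≤ 1.79 := by
    rw [hv]
    refine (norm_add_le _ _).trans ?_
    rw [norm_one]
    linarith
  obtain ⟨R, hR⟩ : ∃ R, R = 1 + Real.log ‖v‖ := ⟨_, rfl⟩
  obtain ⟨B, hB⟩ : ∃ B, B = v.arg ^ 2 := ⟨_, rfl⟩
  rw [← hB] at hA hA1
  have hB0 : 0 ≤ B := hB ▸ sq_nonneg _
  have hBR : B < 2 * (R - Real.exp (-1)) := by linarith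
  have hRlow : Real.exp (-1) < R := by linarith
  have hRpos : 0 < R := hinvpos.trans hRlow
  have hRup : R ≤ 1.6 := by
    have : Real.log ‖v‖ ≤ 0.6 := by
      rw [Real.log_le_iff_le_exp hv0]
      refine hv179.trans (le_trans ?_ (Real.sum_four_le_exp (by norm_num)))
      norm_num
    linarith
  obtain ⟨t, ht⟩ : ∃ t, t = 1 + Complex.log v := ⟨_, rfl⟩
  rw [← ht]
  have htre : t.re = R := by rw [ht, hR]; simp [Complex.log_re]
  have htim : t.im = v.arg := by rw [ht]; simp [Complex.log_im]
  have htn : ‖t‖ ^ 2 = R ^ 2 + B := by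
    rw [Complex.sq_norm, Complex.normSq_apply, htre, htim, hB]; ring
  have htpos : 0 < ‖t‖ := norm_pos_iff.2 fun h => by rw [h] at htre; simp at htre; linarith
  have hlt : Real.log ‖t‖ = 1 / 2 * Real.log (R ^ 2 + B) := by
    rw [← htn, Real.log_pow]; push_cast; ring
  have hkey : (1 + 1 / 2 * Real.log (R ^ 2 + B)) ^ 2 < 2 * (1 + Real.log R) := by
    rcases le_total R 0.85 with h | h
    · have hr1 : 1 < Real.exp 1 * R := by
        calc 1 = Real.exp 1 * Real.exp (-1) := heinv.symm
          _ < _ := by gcongr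
      have hmain := half_log_sq_lt_two_log hr1 (by nlinarith)
      have hlog : Real.log (Real.exp 1 * R) = 1 + Real.log R := by
        rw [Real.log_mul (Real.exp_pos _).ne' hRpos.ne', Real.log_exp]
      rw [hlog] at hmain
      refine lt_of_le_of_lt (pow_le_pow_left₀ ?_ ?_ 2) hmain
      · rw [← hlt]
        have h5 : Real.log R ≤ Real.log ‖t‖ := by
          rw [← htre]
          exact Real.log_le_log (htre ▸ hRpos) (Complex.re_le_norm t)
        have h6 := Real.log_pos hr1
        linarith
      · have h7 : 1 + 1 / 2 * Real.log (R ^ 2 + B)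
            = 1 / 2 * Real.log (Real.exp 1 ^ 2 * (R ^ 2 + B)) := by
          rw [Real.log_mul (by positivity) (by positivity), Real.log_pow, Real.log_exp]
          push_cast
          ring
        rw [h7]
        have h8 : Real.exp 1 ^ 2 * (R ^ 2 + B)
            ≤ (Real.exp 1 * R) ^ 2 + 2 * Real.exp 1 * (Real.exp 1 * R - 1) := by
          have h9 : Real.exp 1 ^ 2 * B ≤ Real.exp 1 ^ 2 * (2 * (R - Real.exp (-1))) := by
            gcongr
          have h10 : Real.exp 1 ^ 2 * (2 * (R - Real.exp (-1)))
              = 2 * Real.exp 1 * (Real.exp 1 * R - Real.exp 1 * Real.exp (-1)) := by ring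
          rw [h10, heinv] at h9
          linarith
        have := Real.log_le_log (by positivity) h8
        linarith
    · exact one_add_half_log_sq_lt h hRup hB0 hA1
  have h4 := Complex.norm_log_sq_le (htre ▸ hRpos : 0 < t.re)
  rw [hlt, htre] at h4
  have : ‖Complex.log t‖ ^ 2 < 1 ^ 2 := by linarith
  exact lt_of_pow_lt_pow_left₀ 2 zero_le_one this

/-- A majorant of the derivative along rays integrates to a majorant of the function. -/
theorem norm_le_of_norm_deriv_le {F : ℂ → ℂ} {φ φ' : ℝ → ℝ}
    (hF : ∀ z, ‖z‖ < 1 → DifferentiableAt ℂ F z) (h0 : ‖F 0‖ ≤ φ 0)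
    (hφ : ∀ r, 0 ≤ r → r < 1 → HasDerivAt φ (φ' r) r)
    (hle : ∀ z, ‖z‖ < 1 → ‖deriv F z‖ ≤ φ' ‖z‖) {z : ℂ} (hz : ‖z‖ < 1) : ‖F z‖ ≤ φ ‖z‖ := by
  have hr : ∀ t ∈ Set.Icc (0 : ℝ) 1, t * ‖z‖ < 1 := fun t ht =>
    (mul_le_of_le_one_left (norm_nonneg z) ht.2).trans_lt hz
  have hnorm : ∀ t ∈ Set.Icc (0 : ℝ) 1, ‖(t : ℂ) * z‖ = t * ‖z‖ := fun t ht => by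
    rw [norm_mul, Complex.norm_real, Real.norm_of_nonneg ht.1]
  have hd1 : ∀ t ∈ Set.Icc (0 : ℝ) 1,
      HasDerivAt (fun t : ℝ => F (t * z)) (deriv F (t * z) * z) t := fun t ht => by
    have h1 : HasDerivAt (fun τ : ℝ => (τ : ℂ) * z) z t := by
      simpa using ((hasDerivAt_id (t : ℂ)).mul_const z).comp_ofReal
    exact (hF (t * z) (by rw [hnorm t ht]; exact hr t ht)).hasDerivAt.comp t h1
  have hd2 : ∀ t ∈ Set.Icc (0 : ℝ) 1,
      HasDerivAt (fun t : ℝ => φ (t * ‖z‖)) (φ' (t * ‖z‖) * ‖z‖) t := fun t ht => by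
    have h1 : HasDerivAt (fun τ : ℝ => τ * ‖z‖) ‖z‖ t := by
      simpa using (hasDerivAt_id t).mul_const ‖z‖
    exact (hφ _ (mul_nonneg ht.1 (norm_nonneg z)) (hr t ht)).comp t h1
  have := image_norm_le_of_norm_deriv_right_le_deriv_boundary' (a := 0) (b := 1)
    (f := fun t : ℝ => F (t * z)) (B := fun t : ℝ => φ (t * ‖z‖))
    (fun t ht => (hd1 t ht).continuousAt.continuousWithinAt)
    (fun t ht => (hd1 t ⟨ht.1, ht.2.le⟩).hasDerivWithinAt) (by simpa using h0)
    (fun t ht => (hd2 t ht).continuousAt.continuousWithinAt)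
    (fun t ht => (hd2 t ⟨ht.1, ht.2.le⟩).hasDerivWithinAt)
    (fun t ht => by
      have ht' : t ∈ Set.Icc (0 : ℝ) 1 := ⟨ht.1, ht.2.le⟩
      rw [norm_mul, ← hnorm t ht']
      exact mul_le_mul_of_nonneg_right (hle _ (by rw [hnorm t ht']; exact hr t ht'))
        (norm_nonneg z))
    (Set.right_mem_Icc.2 zero_le_one)
  simpa using this

theorem one_sub_re_pos {z : ℂ} (hz : ‖z‖ < 1) : 0 < (1 - z).re := by
  have := (Complex.re_le_norm z).trans_lt hz
  simp
  linarith

theorem hasDerivAt_log_one_sub {z : ℂ} (hz : ‖z‖ < 1) :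
    HasDerivAt (fun z => Complex.log (1 - z)) (-(1 - z)⁻¹) z := by
  have := ((hasDerivAt_id z).const_sub 1).clog (Or.inl (one_sub_re_pos hz))
  simpa [div_eq_mul_inv] using this

theorem hasDerivAt_real_log_one_sub {r : ℝ} (hr : r < 1) :
    HasDerivAt (fun r => Real.log (1 - r)) (-(1 - r)⁻¹) r := by
  have := ((hasDerivAt_id r).const_sub 1).log (by simpa using (sub_pos.2 hr).ne')
  simpa [div_eq_mul_inv] using this

theorem one_sub_norm_le (z : ℂ) : 1 - ‖z‖ ≤ ‖1 - z‖ := by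
  have := norm_sub_norm_le (1 : ℂ) z
  rwa [norm_one] at this

theorem norm_log_one_sub_le {z : ℂ} (hz : ‖z‖ < 1) :
    ‖Complex.log (1 - z)‖ ≤ -Real.log (1 - ‖z‖) := by
  refine norm_le_of_norm_deriv_le (F := fun z => Complex.log (1 - z))
    (φ := fun r => -Real.log (1 - r)) (φ' := fun r => (1 - r)⁻¹)
    (fun z hz => (hasDerivAt_log_one_sub hz).differentiableAt) (by simp)
    (fun r _ hr => (hasDerivAt_real_log_one_sub hr).neg.congr_deriv (neg_neg _)) (fun z hz => ?_) hz
  rw [(hasDerivAt_log_one_sub hz).deriv, norm_neg, norm_inv]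
  exact inv_anti₀ (sub_pos.2 hz) (one_sub_norm_le z)

/-- `z + (1 - z) log (1 - z) = ∑ zⁿ / (n (n - 1))` is dominated by its values on the positive
half-axis. -/
theorem norm_add_one_sub_mul_log_le {z : ℂ} (hz : ‖z‖ < 1) :
    ‖z + (1 - z) * Complex.log (1 - z)‖ ≤ ‖z‖ + (1 - ‖z‖) * Real.log (1 - ‖z‖) := by
  have hd : ∀ z : ℂ, ‖z‖ < 1 → HasDerivAt (fun z => z + (1 - z) * Complex.log (1 - z))
      (-Complex.log (1 - z)) z := fun z hz => by
    have hne : 1 - z ≠ 0 := fun h => by simpa [h] using one_sub_re_pos hz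
    refine ((hasDerivAt_id z).add (((hasDerivAt_id z).const_sub 1).mul
      (hasDerivAt_log_one_sub hz))).congr_deriv ?_
    simp [hne]
  refine norm_le_of_norm_deriv_le (F := fun z => z + (1 - z) * Complex.log (1 - z))
    (φ := fun r => r + (1 - r) * Real.log (1 - r)) (φ' := fun r => -Real.log (1 - r))
    (fun z hz => (hd z hz).differentiableAt) (by simp) (fun r _ hr => ?_) (fun z hz => ?_) hz
  · have hne : 1 - r ≠ 0 := (sub_pos.2 hr).ne'
    refine ((hasDerivAt_id r).add (((hasDerivAt_id r).const_sub 1).mul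
      (hasDerivAt_real_log_one_sub hr))).congr_deriv ?_
    simp [hne]
  · rw [(hd z hz).deriv, norm_neg]
    exact norm_log_one_sub_le hz

theorem one_sub_log_one_sub_re_pos {z : ℂ} (hz : ‖z‖ < 1) :
    0 < (1 - Complex.log (1 - z)).re := by
  have hpos : 0 < ‖1 - z‖ := norm_pos_iff.2 fun h => by simpa [h] using one_sub_re_pos hz
  have h2 : ‖1 - z‖ ≤ 2 := by
    have := norm_sub_le (1 : ℂ) z
    rw [norm_one] at this
    linarith
  have h3 := Real.log_le_log hpos h2
  have h4 := Real.log_two_lt_d9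
  rw [Complex.sub_re, Complex.log_re, Complex.one_re]
  linarith

theorem norm_log_one_sub_log_one_sub_le {z : ℂ} (hz : ‖z‖ < 1) :
    ‖Complex.log (1 - Complex.log (1 - z))‖ ≤ Real.log (1 - Real.log (1 - ‖z‖)) := by
  have hd : ∀ z : ℂ, ‖z‖ < 1 → HasDerivAt (fun z => Complex.log (1 - Complex.log (1 - z)))
      ((1 - (z + (1 - z) * Complex.log (1 - z)))⁻¹) z := fun z hz => by
    have hne : 1 - z ≠ 0 := fun h => by simpa [h] using one_sub_re_pos hz
    refine (((hasDerivAt_log_one_sub hz).const_sub 1).clog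
      (Or.inl (one_sub_log_one_sub_re_pos hz))).congr_deriv ?_
    rw [neg_neg, div_eq_mul_inv, ← mul_inv]
    congr 1
    ring
  have hlog : ∀ r : ℝ, 0 ≤ r → r < 1 → Real.log (1 - r) ≤ 0 := fun r h0 h1 =>
    Real.log_nonpos (by linarith) (by linarith)
  refine norm_le_of_norm_deriv_le (F := fun z => Complex.log (1 - Complex.log (1 - z)))
    (φ := fun r => Real.log (1 - Real.log (1 - r)))
    (φ' := fun r => (1 - (r + (1 - r) * Real.log (1 - r)))⁻¹)
    (fun z hz => (hd z hz).differentiableAt) (by simp) (fun r hr0 hr => ?_) (fun z hz => ?_) hz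
  · have := hlog r hr0 hr
    refine (((hasDerivAt_real_log_one_sub hr).const_sub 1).log (by linarith)).congr_deriv ?_
    rw [neg_neg, div_eq_mul_inv, ← mul_inv]
    congr 1
    ring
  · rw [(hd z hz).deriv, norm_inv]
    have h1 := norm_add_one_sub_mul_log_le hz
    have h2 : 0 < 1 - (‖z‖ + (1 - ‖z‖) * Real.log (1 - ‖z‖)) := by
      have h3 : (1 - ‖z‖) * (1 - Real.log (1 - ‖z‖)) > 0 :=
        mul_pos (sub_pos.2 hz) (by linarith [hlog _ (norm_nonneg z) hz])
      linarith
    exact inv_anti₀ h2 ((sub_le_sub_left h1 1).trans (one_sub_norm_le _))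

theorem norm_log_one_sub_log_one_sub_lt_one {z : ℂ} (hz : ‖z‖ < 1 - Real.exp (1 - Real.exp 1)) :
    ‖Complex.log (1 - Complex.log (1 - z))‖ < 1 := by
  have hpos := Real.exp_pos (1 - Real.exp 1)
  have hz1 : ‖z‖ < 1 := by linarith
  refine (norm_log_one_sub_log_one_sub_le hz1).trans_lt ?_
  have h1 : 1 - Real.exp 1 < Real.log (1 - ‖z‖) := by
    rw [Real.lt_log_iff_exp_lt (by linarith)]
    linarith
  have h2 : Real.log (1 - ‖z‖) ≤ 0 :=
    Real.log_nonpos (by linarith) (by linarith [norm_nonneg z])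
  rw [Real.log_lt_iff_lt_exp (by linarith)]
  linarith

theorem mem_unitDisc {z : ℂ} : z ∈ unitDisc ↔ ‖z‖ < 1 := by
  rw [unitDisc, mem_ball_zero_iff]

theorem isOpen_unitDisc : IsOpen unitDisc := Metric.isOpen_ball

theorem analyticOnNhd_unitDisc {f : ℂ → ℂ} (h : ∀ z, ‖z‖ < 1 → DifferentiableAt ℂ f z) :
    AnalyticOnNhd ℂ f unitDisc :=
  DifferentiableOn.analyticOnNhd
    (fun z hz => (h z (mem_unitDisc.1 hz)).differentiableWithinAt) isOpen_unitDisc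

/-- Exponential representation criterion for subordination to `bellQ`. -/
theorem subordinate_bellQ_of_exp {p L : ℂ → ℂ}
    (hL : ∀ z, ‖z‖ < 1 → DifferentiableAt ℂ L z) (hL0 : L 0 = 0)
    (hp : ∀ z, ‖z‖ < 1 → p z = Complex.exp (L z)) (hre : ∀ z, ‖z‖ < 1 → 0 < (1 + L z).re)
    (hlog : ∀ z, ‖z‖ < 1 → ‖Complex.log (1 + L z)‖ < 1) : Subordinate p bellQ := by
  refine ⟨fun z => Complex.log (1 + L z), analyticOnNhd_unitDisc fun z hz =>
    ((hL z hz).const_add 1).clog (Or.inl (hre z hz)), by simp [hL0],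
    fun z hz => hlog z (mem_unitDisc.1 hz), fun z hz => ?_⟩
  have hz' := mem_unitDisc.1 hz
  have hne : 1 + L z ≠ 0 := fun h => by simpa [h] using hre z hz'
  rw [bellQ, Complex.exp_log hne, add_sub_cancel_left, hp z hz']

theorem exists_eq_mul_cardioidPrimitive {q w : ℂ → ℂ} {β c : ℝ} (hc : 0 < c) (hβ : 1 / c ≤ β)
    (hq : ∀ z, ‖z‖ < 1 → DifferentiableAt ℂ q z) (hq0 : q 0 = 0)
    (hw : ∀ z, ‖z‖ < 1 → ‖w z‖ < 1)
    (h : ∀ z, ‖z‖ < 1 → (β : ℂ) * (z * deriv q z) = 2 / 3 * (2 * w z + w z ^ 2))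
    {z : ℂ} (hz : ‖z‖ < 1) : ∃ ω : ℂ, ‖ω‖ < 1 ∧ q z = c * cardioidPrimitive ω := by
  have hβ0 : 0 < β := lt_of_lt_of_le (by positivity) hβ
  have hcC : (c : ℂ) ≠ 0 := by exact_mod_cast hc.ne'
  have hβC : (β : ℂ) ≠ 0 := by exact_mod_cast hβ0.ne'
  obtain ⟨ω, h1, h2⟩ := exists_cardioidPrimitive_eq (P := fun z => q z / c) (w := w)
    (s := 1 / (β * c)) (by positivity) (by
      rw [div_le_one (by positivity)]
      rwa [div_le_iff₀ hc] at hβ)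
    (fun z hz => ((hq z (by simpa using hz)).div_const _).differentiableWithinAt)
    (by simp [hq0]) hw (fun z hz => by
      rw [deriv_div_const, ← h z hz]
      push_cast
      field_simp) hz
  refine ⟨ω, h1, ?_⟩
  rw [← h2]
  field_simp

/-- A solution of `p' = p g`, where the equation is only known off the zeros of `p`, is the
exponential of a primitive of `g`. -/
theorem exists_primitive_eq_exp {p g : ℂ → ℂ} (hp : ∀ z, ‖z‖ < 1 → DifferentiableAt ℂ p z)
    (hp0 : p 0 = 1) (hg : ∀ z, ‖z‖ < 1 → DifferentiableAt ℂ g z)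
    (h : ∀ z, ‖z‖ < 1 → p z ≠ 0 → z ≠ 0 → deriv p z = p z * g z) :
    ∃ L : ℂ → ℂ, L 0 = 0 ∧ (∀ z, ‖z‖ < 1 → HasDerivAt L (g z) z) ∧
      ∀ z, ‖z‖ < 1 → p z = Complex.exp (L z) := by
  have hex : Complex.IsExactOn g (Metric.ball 0 1) := DifferentiableOn.isExactOn_ball
    fun z hz => (hg z (by simpa using hz)).differentiableWithinAt
  obtain ⟨L, hL0, hL⟩ := hex.with_val_at 0 0
  have hL' : ∀ z, ‖z‖ < 1 → HasDerivAt L (g z) z := fun z hz => hL z (by simpa using hz)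
  refine ⟨L, hL0, hL', ?_⟩
  have hd : ∀ z, ‖z‖ < 1 → HasDerivAt (fun z => p z * Complex.exp (-L z))
      ((deriv p z - p z * g z) * Complex.exp (-L z)) z := fun z hz =>
    ((hp z hz).hasDerivAt.mul (hL' z hz).neg.cexp).congr_deriv (by rw [Pi.neg_apply]; ring)
  have hpan := analyticOnNhd_unitDisc hp
  have hE : AnalyticOnNhd ℂ (fun z => deriv p z - p z * g z) unitDisc :=
    hpan.deriv.sub (hpan.mul (analyticOnNhd_unitDisc hg))
  have hzero : Set.EqOn (fun z => deriv p z - p z * g z) 0 unitDisc := by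
    refine hE.eqOn_zero_of_preconnected_of_frequently_eq_zero
      (convex_ball (0 : ℂ) 1).isPreconnected (z₀ := 0) (by simp [mem_unitDisc]) ?_
    refine Filter.Eventually.frequently ?_
    have h1 : ∀ᶠ z in nhds (0 : ℂ), p z ≠ 0 :=
      (hp 0 (by simp)).continuousAt.eventually_ne (by simp [hp0])
    have h2 : ∀ᶠ z in nhds (0 : ℂ), ‖z‖ < 1 := by
      filter_upwards [Metric.ball_mem_nhds (0 : ℂ) one_pos] with z hz using by simpa using hz
    filter_upwards [h1.filter_mono nhdsWithin_le_nhds, h2.filter_mono nhdsWithin_le_nhds,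
      self_mem_nhdsWithin] with z hz1 hz2 hz3
    rw [h z hz2 hz1 hz3, sub_self]
  intro z hz
  have hconst : p z * Complex.exp (-L z) = p 0 * Complex.exp (-L 0) := by
    refine (convex_ball (0 : ℂ) 1).is_const_of_fderivWithin_eq_zero (𝕜 := ℂ)
      (f := fun z => p z * Complex.exp (-L z))
      (fun y hy => (hd y (by simpa using hy)).differentiableAt.differentiableWithinAt)
      (fun y hy => ?_) (by simpa using hz) (by simp)
    have hy' : ‖y‖ < 1 := by simpa using hy
    rw [fderivWithin_of_isOpen Metric.isOpen_ball hy]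
    have h0 : deriv p y - p y * g y = 0 := hzero (mem_unitDisc.2 hy')
    have h3 := hd y hy'
    rw [h0, zero_mul] at h3
    ext
    simp [h3.deriv]
  rw [hL0, hp0, neg_zero, Complex.exp_zero, mul_one, Complex.exp_neg] at hconst
  rwa [mul_inv_eq_one₀ (Complex.exp_ne_zero _)] at hconst

/-- The quotient of `phiC ∘ w - 1` by the identity. -/
theorem exists_mul_eq_of_map_zero {w : ℂ → ℂ} (hw : AnalyticOnNhd ℂ w unitDisc) (hw0 : w 0 = 0) :
    ∃ g : ℂ → ℂ, (∀ z, ‖z‖ < 1 → DifferentiableAt ℂ g z) ∧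
      ∀ z, z * g z = 2 / 3 * (2 * w z + w z ^ 2) := by
  set k : ℂ → ℂ := fun z => 2 / 3 * (2 * w z + w z ^ 2) with hk
  have hk0 : k 0 = 0 := by simp [hk, hw0]
  refine ⟨dslope k 0, fun z hz => ?_, fun z => ?_⟩
  · have hkd : DifferentiableOn ℂ k (Metric.ball 0 1) := fun y hy => by
      have := (hw y hy).differentiableAt
      exact (DifferentiableAt.const_mul ((this.const_mul 2).add (this.pow 2)) _).differentiableWithinAt
    exact ((Complex.differentiableOn_dslope (Metric.ball_mem_nhds _ one_pos)).2 hkd).differentiableAt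
      (Metric.isOpen_ball.mem_nhds (by simpa using hz))
  · have := sub_smul_dslope k 0 z
    simpa [hk0] using this

theorem mul_eq_of_one_add_eq_phiC {X w : ℂ} (h : 1 + X = phiC w) :
    X = 2 / 3 * (2 * w + w ^ 2) := by
  rw [phiC] at h
  linear_combination h

theorem subordinate_of_psiOp {β : ℝ} (hβ : 1 / (1 - Real.exp (Real.exp (-1) - 1)) ≤ β)
    {p : ℂ → ℂ} (hp : AnalyticOnNhd ℂ p unitDisc) (hp0 : p 0 = 1)
    (h : Subordinate (psiOp β p) phiC) : Subordinate p bellQ := by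
  obtain ⟨w, -, -, hw1, hw⟩ := h
  obtain ⟨c, hc⟩ : ∃ c, c = 1 - Real.exp (Real.exp (-1) - 1) := ⟨_, rfl⟩
  rw [← hc] at hβ
  have hlt1 : Real.exp (-1) < 1 := (Real.exp_lt_exp.2 (by norm_num)).trans_eq Real.exp_zero
  have hexp1 : Real.exp (Real.exp (-1) - 1) < 1 :=
    (Real.exp_lt_exp.2 (by linarith)).trans_eq Real.exp_zero
  have hc0 : 0 < c := by linarith
  have hcu : c ≤ 0.474 := by
    have he0 := Real.exp_one_gt_d9
    have he := Real.exp_one_lt_d9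
    have h1 : 0.3678 ≤ Real.exp (-1) := by
      rw [Real.exp_neg, le_inv_comm₀ (by norm_num) (Real.exp_pos _)]
      refine he.le.trans ?_
      norm_num
    have h2 : Real.exp (-0.6322) ≤ Real.exp (Real.exp (-1) - 1) := by
      rw [Real.exp_le_exp]; linarith
    have h3 : 0.526 ≤ Real.exp (-0.6322) := by
      rw [Real.exp_neg, le_inv_comm₀ (by norm_num) (Real.exp_pos _)]
      refine (Real.exp_le_of_le_one (by norm_num) (by norm_num)).trans ?_
      norm_num
    linarith
  have hpd : ∀ z, ‖z‖ < 1 → DifferentiableAt ℂ p z := fun z hz =>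
    (hp z (mem_unitDisc.2 hz)).differentiableAt
  have key : ∀ z, ‖z‖ < 1 → ∃ u : ℂ, Real.exp (Real.exp (-1) - 1) - 1 < u.re ∧ ‖u‖ ≤ 0.79 ∧
      p z = 1 + u := by
    intro z hz
    obtain ⟨ω, h1, h2⟩ := exists_eq_mul_cardioidPrimitive (q := fun z => p z - 1) hc0 hβ
      (fun z hz => (hpd z hz).sub_const 1) (by simp [hp0]) (fun z hz => hw1 z (mem_unitDisc.2 hz))
      (fun z hz => by
        rw [deriv_sub_const]
        exact mul_eq_of_one_add_eq_phiC (hw z (mem_unitDisc.2 hz))) hz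
    refine ⟨c * cardioidPrimitive ω, ?_, ?_, by rw [← h2]; ring⟩
    · rw [Complex.re_ofReal_mul]
      have := mul_lt_mul_of_pos_left (neg_one_lt_re_cardioidPrimitive h1) hc0
      linarith
    · rw [norm_mul, Complex.norm_real, Real.norm_of_nonneg hc0.le]
      have := norm_cardioidPrimitive_lt h1
      nlinarith [norm_nonneg (cardioidPrimitive ω)]
  have hpre : ∀ z, ‖z‖ < 1 → Real.exp (Real.exp (-1) - 1) < (p z).re := by
    intro z hz
    obtain ⟨u, h1, -, h3⟩ := key z hz
    rw [h3, Complex.add_re, Complex.one_re]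
    linarith
  have hppos : ∀ z, ‖z‖ < 1 → 0 < (p z).re := fun z hz => (Real.exp_pos _).trans (hpre z hz)
  refine subordinate_bellQ_of_exp (L := fun z => Complex.log (p z))
    (fun z hz => (hpd z hz).clog (Or.inl (hppos z hz))) (by simp [hp0])
    (fun z hz => (Complex.exp_log fun h0 => by simpa [h0] using hppos z hz).symm)
    (fun z hz => ?_) (fun z hz => ?_)
  · rw [Complex.add_re, Complex.one_re, Complex.log_re]
    have h1 : Real.exp (-1) - 1 < Real.log (p z).re := by
      rw [Real.lt_log_iff_exp_lt (hppos z hz)]; exact hpre z hz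
    have h2 := Real.log_le_log (hppos z hz) (Complex.re_le_norm (p z))
    have := Real.exp_pos (-1)
    linarith
  · obtain ⟨u, h1, h2, h3⟩ := key z hz
    simp only [h3]
    exact norm_log_one_add_log_one_add_lt_one h1 h2

theorem subordinate_of_lambdaOp {β : ℝ} (hβ : Real.exp 1 / (Real.exp 1 - 1) ≤ β)
    {p : ℂ → ℂ} (hp : AnalyticOnNhd ℂ p unitDisc) (hp0 : p 0 = 1)
    (h : Subordinate (lambdaOp β p) phiC) : Subordinate p bellQ := by
  obtain ⟨w, hwa, hw0, hw1, hw⟩ := h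
  have he0 := Real.exp_one_gt_d9
  have hc : 1 / (1 - Real.exp (-1)) = Real.exp 1 / (Real.exp 1 - 1) := by
    rw [Real.exp_neg]
    field_simp
  rw [← hc] at hβ
  have hlt1 : Real.exp (-1) < 1 := (Real.exp_lt_exp.2 (by norm_num)).trans_eq Real.exp_zero
  have hc0 : 0 < 1 - Real.exp (-1) := by linarith
  have hβ0 : 0 < β := lt_of_lt_of_le (by positivity) hβ
  have hβC : (β : ℂ) ≠ 0 := by exact_mod_cast hβ0.ne'
  have hpd : ∀ z, ‖z‖ < 1 → DifferentiableAt ℂ p z := fun z hz =>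
    (hp z (mem_unitDisc.2 hz)).differentiableAt
  obtain ⟨g, hg, hgw⟩ := exists_mul_eq_of_map_zero hwa hw0
  obtain ⟨L, hL0, hL, hpL⟩ := exists_primitive_eq_exp (g := fun z => g z / β) hpd hp0
    (fun z hz => (hg z hz).div_const _) (fun z hz hpz hz0 => by
      have h1 := mul_eq_of_one_add_eq_phiC (hw z (mem_unitDisc.2 hz))
      rw [← hgw z] at h1
      field_simp at h1 ⊢
      linear_combination h1)
  have key : ∀ z, ‖z‖ < 1 → ∃ ω : ℂ, ‖ω‖ < 1 ∧
      L z = (1 - Real.exp (-1) : ℝ) * cardioidPrimitive ω := fun z hz =>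
    exists_eq_mul_cardioidPrimitive hc0 hβ (fun z hz => (hL z hz).differentiableAt) hL0
      (fun z hz => hw1 z (mem_unitDisc.2 hz)) (fun z hz => by
        rw [(hL z hz).deriv, ← hgw z]
        field_simp) hz
  refine subordinate_bellQ_of_exp (fun z hz => (hL z hz).differentiableAt) hL0 hpL
    (fun z hz => ?_) (fun z hz => ?_)
  · obtain ⟨ω, h1, h2⟩ := key z hz
    rw [h2, Complex.add_re, Complex.one_re, Complex.re_ofReal_mul]
    have := mul_lt_mul_of_pos_left (neg_one_lt_re_cardioidPrimitive h1) hc0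
    have := Real.exp_pos (-1)
    linarith
  · obtain ⟨ω, h1, h2⟩ := key z hz
    rw [h2]
    exact norm_log_one_add_lt_one h1

theorem subordinate_of_thetaOp {β : ℝ}
    (hβ : 5 * Real.exp (Real.exp 1 - 1) / (3 * (Real.exp (Real.exp 1 - 1) - 1)) ≤ β)
    {p : ℂ → ℂ} (hp : AnalyticOnNhd ℂ p unitDisc) (hp0 : p 0 = 1)
    (h : Subordinate (thetaOp β p) phiC) : Subordinate p bellQ := by
  obtain ⟨w, hwa, hw0, hw1, hw⟩ := h
  have he0 := Real.exp_one_gt_d9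
  have hE1 : 1 < Real.exp (Real.exp 1 - 1) := Real.one_lt_exp_iff.2 (by linarith)
  obtain ⟨c, hcdef⟩ : ∃ c, c = 3 / 5 * (1 - Real.exp (1 - Real.exp 1)) := ⟨_, rfl⟩
  have hinv : Real.exp (1 - Real.exp 1) = (Real.exp (Real.exp 1 - 1))⁻¹ := by
    rw [← Real.exp_neg, neg_sub]
  have hc0 : 0 < c := by
    have := inv_lt_one_of_one_lt₀ hE1
    rw [hcdef, hinv]
    linarith
  have hc : 1 / c = 5 * Real.exp (Real.exp 1 - 1) / (3 * (Real.exp (Real.exp 1 - 1) - 1)) := by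
    have hne : Real.exp (Real.exp 1 - 1) - 1 ≠ 0 := by linarith
    rw [hcdef, hinv]
    field_simp
  rw [← hc] at hβ
  have hβ0 : 0 < β := lt_of_lt_of_le (by positivity) hβ
  have hβC : (β : ℂ) ≠ 0 := by exact_mod_cast hβ0.ne'
  have hpd : ∀ z, ‖z‖ < 1 → DifferentiableAt ℂ p z := fun z hz =>
    (hp z (mem_unitDisc.2 hz)).differentiableAt
  obtain ⟨g, hg, hgw⟩ := exists_mul_eq_of_map_zero hwa hw0
  obtain ⟨L, hL0, hL, hpL⟩ := exists_primitive_eq_exp (g := fun z => p z * g z / β) hpd hp0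
    (fun z hz => ((hpd z hz).mul (hg z hz)).div_const _) (fun z hz hpz hz0 => by
      have h1 := mul_eq_of_one_add_eq_phiC (hw z (mem_unitDisc.2 hz))
      rw [← hgw z] at h1
      field_simp at h1 ⊢
      linear_combination h1)
  have hpne : ∀ z, ‖z‖ < 1 → p z ≠ 0 := fun z hz => by
    rw [hpL z hz]; exact Complex.exp_ne_zero _
  have hq : ∀ z, ‖z‖ < 1 → HasDerivAt (fun z => 1 - (p z)⁻¹) (deriv p z / p z ^ 2) z :=
    fun z hz => (((hpd z hz).hasDerivAt.inv (hpne z hz)).const_sub 1).congr_deriv (by ring)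
  have key : ∀ z, ‖z‖ < 1 → ‖1 - (p z)⁻¹‖ < 1 - Real.exp (1 - Real.exp 1) := fun z hz => by
    obtain ⟨ω, h1, h2⟩ := exists_eq_mul_cardioidPrimitive (q := fun z => 1 - (p z)⁻¹) hc0 hβ
      (fun z hz => (hq z hz).differentiableAt) (by simp [hp0])
      (fun z hz => hw1 z (mem_unitDisc.2 hz)) (fun z hz => by
        rw [(hq z hz).deriv, ← mul_div_assoc]
        exact mul_eq_of_one_add_eq_phiC (hw z (mem_unitDisc.2 hz))) hz
    rw [h2, norm_mul, Complex.norm_real, Real.norm_of_nonneg hc0.le]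
    have := mul_lt_mul_of_pos_left (norm_cardioidPrimitive_lt h1) hc0
    linarith
  have key1 : ∀ z, ‖z‖ < 1 → ‖1 - (p z)⁻¹‖ < 1 := fun z hz => by
    have := key z hz
    have := Real.exp_pos (1 - Real.exp 1)
    linarith
  refine subordinate_bellQ_of_exp (L := fun z => -Complex.log (1 - (1 - (p z)⁻¹)))
    (fun z hz => (HasDerivAt.comp z (hasDerivAt_log_one_sub (key1 z hz))
      (hq z hz)).differentiableAt.fun_neg)
    (by simp [hp0]) (fun z hz => ?_) (fun z hz => ?_) (fun z hz => ?_)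
  · rw [Complex.exp_neg, sub_sub_cancel, Complex.exp_log (inv_ne_zero (hpne z hz)), inv_inv]
  · rw [← sub_eq_add_neg]
    exact one_sub_log_one_sub_re_pos (key1 z hz)
  · rw [← sub_eq_add_neg]
    exact norm_log_one_sub_log_one_sub_lt_one (key z hz)

theorem bellQ_injOn : Set.InjOn bellQ (Metric.closedBall 0 1) := by
  intro z hz w hw h
  have hexp : ∀ u ∈ Metric.closedBall (0 : ℂ) 1, |(Complex.exp u - 1).im| < Real.pi := by
    intro u hu
    have h1 : |(Complex.exp u - 1).im| ≤ ‖Complex.exp u‖ := by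
      simpa using Complex.abs_im_le_norm (Complex.exp u)
    have h2 : ‖Complex.exp u‖ ≤ Real.exp 1 := by
      rw [Complex.norm_exp, Real.exp_le_exp]
      exact (Complex.re_le_norm u).trans (by simpa using hu)
    have := Real.exp_one_lt_d9
    have := Real.pi_gt_three
    linarith
  have him : ∀ u ∈ Metric.closedBall (0 : ℂ) 1, |u.im| < Real.pi := by
    intro u hu
    have h1 : ‖u‖ ≤ 1 := by simpa using hu
    have := Complex.abs_im_le_norm u
    have := Real.pi_gt_three
    linarith
  have h1 := Complex.exp_inj_of_neg_pi_lt_of_le_pi (abs_lt.1 (hexp z hz)).1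
    (abs_lt.1 (hexp z hz)).2.le (abs_lt.1 (hexp w hw)).1 (abs_lt.1 (hexp w hw)).2.le h
  exact Complex.exp_inj_of_neg_pi_lt_of_le_pi (abs_lt.1 (him z hz)).1
    (abs_lt.1 (him z hz)).2.le (abs_lt.1 (him w hw)).1 (abs_lt.1 (him w hw)).2.le (sub_left_inj.1 h1)

theorem not_subordinate_bellQ {p : ℂ → ℂ} {z ζ : ℂ} (hz : ‖z‖ < 1) (hζ : ‖ζ‖ = 1)
    (h : p z = bellQ ζ) : ¬ Subordinate p bellQ := by
  rintro ⟨w, -, -, hw1, hw⟩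
  have h1 := hw1 z (mem_unitDisc.2 hz)
  have h2 : w z = ζ := bellQ_injOn (by simpa using h1.le) (by simpa using hζ.le)
    (by rw [← hw z (mem_unitDisc.2 hz), h])
  rw [h2, hζ] at h1
  exact lt_irrefl _ h1

theorem subordinate_phiC_of_dilation {f : ℂ → ℂ} {r : ℝ} (hr0 : 0 ≤ r) (hr1 : r ≤ 1)
    (h : ∀ z, ‖z‖ < 1 → f z = phiC (r * z)) : Subordinate f phiC := by
  refine ⟨fun z => r * z, analyticOnNhd_unitDisc fun z _ => by fun_prop, by simp,
    fun z hz => ?_, fun z hz => h z (mem_unitDisc.1 hz)⟩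
  rw [norm_mul, Complex.norm_real, Real.norm_of_nonneg hr0]
  exact (mul_le_of_le_one_left (norm_nonneg z) hr1).trans_lt (mem_unitDisc.1 hz)

theorem hasDerivAt_cardioidPrimitive_mul_div (r β : ℝ) (z : ℂ) :
    HasDerivAt (fun z => cardioidPrimitive (r * z) / β)
      ((4 * r + 2 * r ^ 2 * z) / 3 / β) z := by
  unfold cardioidPrimitive
  have h1 : HasDerivAt (fun z : ℂ => (r : ℂ) * z) r z := by
    simpa using (hasDerivAt_id z).const_mul (r : ℂ)
  refine ((((h1.const_mul 4).add (h1.pow 2)).div_const 3).div_const (β : ℂ)).congr_deriv ?_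
  push_cast
  ring

theorem cardioidPrimitive_sqrt_sub_two {t : ℝ} (h : 0 ≤ 4 + 3 * t) :
    cardioidPrimitive ((√(4 + 3 * t) - 2 : ℝ) : ℂ) = t := by
  have h1 : ((√(4 + 3 * t) : ℝ) : ℂ) ^ 2 = 4 + 3 * t := by
    rw [← Complex.ofReal_pow, Real.sq_sqrt h]; push_cast; ring
  rw [cardioidPrimitive]
  push_cast
  linear_combination h1 / 3

/-- Solutions of the extremal differential equation attaining a prescribed negative value. -/
theorem exists_extremal_neg {β τ : ℝ} (hβ : 0 ≤ β) (hτ0 : 0 < τ) (hτ1 : τ < 1)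
    (h : β * τ < 1) :
    ∃ (q q' : ℂ → ℂ) (r : ℝ) (x : ℂ), (∀ z, HasDerivAt q (q' z) z) ∧ q 0 = 0 ∧ 0 ≤ r ∧ r ≤ 1 ∧
      (∀ z, 1 + (β : ℂ) * (z * q' z) = phiC (r * z)) ∧ ‖x‖ < 1 ∧ q x = -τ := by
  rcases hβ.eq_or_lt with rfl | hβ
  · refine ⟨id, fun _ => 1, 0, -τ, hasDerivAt_id, rfl, le_rfl, zero_le_one, fun z => ?_, ?_, rfl⟩
    · simp [phiC]
    · rwa [norm_neg, Complex.norm_real, Real.norm_of_nonneg hτ0.le]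
  · have hβC : (β : ℂ) ≠ 0 := by exact_mod_cast hβ.ne'
    have hpos : 0 < β * τ := by positivity
    refine ⟨fun z => cardioidPrimitive ((1 : ℝ) * z) / β, _, 1,
      ((√(4 + 3 * (-(β * τ))) - 2 : ℝ) : ℂ), hasDerivAt_cardioidPrimitive_mul_div 1 β,
      by simp [cardioidPrimitive], zero_le_one, le_rfl, fun z => ?_, ?_, ?_⟩
    · rw [phiC]
      push_cast
      field_simp
      ring
    · rw [Complex.norm_real, Real.norm_eq_abs, abs_lt]
      constructor
      · have : 1 < √(4 + 3 * (-(β * τ))) := by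
          rw [Real.lt_sqrt zero_le_one]; linarith
        linarith
      · have : √(4 + 3 * (-(β * τ))) < 3 := by
          rw [Real.sqrt_lt' (by norm_num)]; linarith
        linarith
    · simp only [Complex.ofReal_one, one_mul]
      rw [cardioidPrimitive_sqrt_sub_two (by linarith)]
      push_cast
      field_simp

/-- Solutions of a dilated extremal differential equation that stay in the disc and attain a
prescribed positive value. -/
theorem exists_extremal_pos {β τ : ℝ} (hβ : 0 ≤ β) (hτ0 : 0 < τ) (hτ1 : τ < 1)
    (h : β * τ < 5 / 3) :
    ∃ (q q' : ℂ → ℂ) (r : ℝ) (x : ℂ), (∀ z, HasDerivAt q (q' z) z) ∧ q 0 = 0 ∧ 0 ≤ r ∧ r ≤ 1 ∧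
      (∀ z, 1 + (β : ℂ) * (z * q' z) = phiC (r * z)) ∧ ‖x‖ < 1 ∧ q x = τ ∧
      ∀ z, ‖z‖ < 1 → ‖q z‖ < 1 := by
  rcases hβ.eq_or_lt with rfl | hβ
  · refine ⟨id, fun _ => 1, 0, τ, hasDerivAt_id, rfl, le_rfl, zero_le_one, fun z => ?_, ?_, rfl,
      fun z hz => hz⟩
    · simp [phiC]
    · rwa [Complex.norm_real, Real.norm_of_nonneg hτ0.le]
  · have hβC : (β : ℂ) ≠ 0 := by exact_mod_cast hβ.ne'
    obtain ⟨s, hs0, hs⟩ := exists_between (lt_min hτ1 ((lt_div_iff₀' hβ).2 h))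
    have hs1 := hs.trans_le (min_le_left _ _)
    have hs2 := (lt_div_iff₀' hβ).1 (hs.trans_le (min_le_right _ _))
    have hβτ : 0 < β * τ := by positivity
    have hτs : β * τ < β * s := mul_lt_mul_of_pos_left hs0 hβ
    set r := √(4 + 3 * (β * s)) - 2 with hr
    set y := √(4 + 3 * (β * τ)) - 2 with hy
    have hy0 : 0 < y := by
      have : 2 < √(4 + 3 * (β * τ)) := by
        rw [Real.lt_sqrt zero_le_two]; linarith
      linarith
    have hyr : y < r := sub_lt_sub_right (Real.sqrt_lt_sqrt (by linarith) (by linarith)) 2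
    have hr0 : 0 < r := hy0.trans hyr
    have hr1 : r ≤ 1 := by
      have : √(4 + 3 * (β * s)) ≤ 3 := by
        rw [Real.sqrt_le_left (by norm_num)]; linarith
      linarith
    have hrs : 4 * r + r ^ 2 = 3 * (β * s) := by
      have := Real.sq_sqrt (by linarith : 0 ≤ 4 + 3 * (β * s))
      rw [hr]
      linarith
    have hrC : (r : ℂ) ≠ 0 := by exact_mod_cast hr0.ne'
    refine ⟨fun z => cardioidPrimitive (r * z) / β, _, r, ((y / r : ℝ) : ℂ),
      hasDerivAt_cardioidPrimitive_mul_div r β, by simp [cardioidPrimitive], hr0.le, hr1,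
      fun z => ?_, ?_, ?_, fun z hz => ?_⟩
    · rw [phiC]
      field_simp
      ring
    · rw [Complex.norm_real, Real.norm_of_nonneg (by positivity), div_lt_one hr0]
      exact hyr
    · have h1 : (r : ℂ) * ((y / r : ℝ) : ℂ) = (y : ℂ) := by
        push_cast
        field_simp
      simp only [h1]
      rw [hy, cardioidPrimitive_sqrt_sub_two (by linarith)]
      push_cast
      field_simp
    · rw [norm_div, Complex.norm_real, Real.norm_of_nonneg hβ.le, div_lt_one hβ]
      have hrz : ‖(r : ℂ) * z‖ ≤ r := by
        rw [norm_mul, Complex.norm_real, Real.norm_of_nonneg hr0.le]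
        exact mul_le_of_le_one_right hr0.le hz.le
      have h2 : ‖cardioidPrimitive (r * z)‖ ≤ (4 * r + r ^ 2) / 3 := by
        rw [cardioidPrimitive, norm_div]
        have h3 := norm_add_le (4 * ((r : ℂ) * z)) (((r : ℂ) * z) ^ 2)
        rw [norm_mul 4, norm_pow ((r : ℂ) * z)] at h3
        have h4 := pow_le_pow_left₀ (norm_nonneg _) hrz 2
        rw [Complex.norm_ofNat] at h3
        rw [Complex.norm_ofNat]
        linarith
      rw [hrs] at h2
      nlinarith

theorem exists_sharp_psiOp {β : ℝ} (hβ0 : 0 ≤ β)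
    (hβ : β < 1 / (1 - Real.exp (Real.exp (-1) - 1))) :
    ∃ p : ℂ → ℂ, AnalyticOnNhd ℂ p unitDisc ∧ p 0 = 1 ∧
      Subordinate (psiOp β p) phiC ∧ ¬ Subordinate p bellQ := by
  have hlt1 : Real.exp (-1) < 1 := (Real.exp_lt_exp.2 (by norm_num)).trans_eq Real.exp_zero
  have hexp1 : Real.exp (Real.exp (-1) - 1) < 1 :=
    (Real.exp_lt_exp.2 (by linarith)).trans_eq Real.exp_zero
  have hpos := Real.exp_pos (Real.exp (-1) - 1)
  obtain ⟨q, q', r, x, hq, hq0, hr0, hr1, hqr, hx, hqx⟩ := exists_extremal_neg hβ0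
    (τ := 1 - Real.exp (Real.exp (-1) - 1)) (by linarith) (by linarith)
    ((lt_div_iff₀ (by linarith)).1 hβ)
  refine ⟨fun z => 1 + q z, analyticOnNhd_unitDisc fun z _ =>
    (hq z).differentiableAt.const_add 1, by simp [hq0],
    subordinate_phiC_of_dilation hr0 hr1 fun z _ => ?_,
    not_subordinate_bellQ (ζ := -1) hx (by simp) ?_⟩
  · rw [psiOp, ((hq z).const_add 1).deriv, hqr]
  · simp only [hqx, bellQ]
    push_cast
    ring

theorem exists_sharp_lambdaOp {β : ℝ} (hβ0 : 0 ≤ β) (hβ : β < Real.exp 1 / (Real.exp 1 - 1)) :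
    ∃ p : ℂ → ℂ, AnalyticOnNhd ℂ p unitDisc ∧ p 0 = 1 ∧ (∀ z ∈ unitDisc, p z ≠ 0) ∧
      Subordinate (lambdaOp β p) phiC ∧ ¬ Subordinate p bellQ := by
  have he0 := Real.exp_one_gt_d9
  have hlt1 : Real.exp (-1) < 1 := (Real.exp_lt_exp.2 (by norm_num)).trans_eq Real.exp_zero
  have hpos := Real.exp_pos (-1)
  have hc : Real.exp 1 / (Real.exp 1 - 1) = 1 / (1 - Real.exp (-1)) := by
    rw [Real.exp_neg]
    field_simp
  rw [hc] at hβ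
  obtain ⟨q, q', r, x, hq, hq0, hr0, hr1, hqr, hx, hqx⟩ := exists_extremal_neg hβ0
    (τ := 1 - Real.exp (-1)) (by linarith) (by linarith) ((lt_div_iff₀ (by linarith)).1 hβ)
  refine ⟨fun z => Complex.exp (q z), analyticOnNhd_unitDisc fun z _ =>
    (hq z).differentiableAt.cexp, by simp [hq0], fun z _ => Complex.exp_ne_zero _,
    subordinate_phiC_of_dilation hr0 hr1 fun z _ => ?_,
    not_subordinate_bellQ (ζ := -1) hx (by simp) ?_⟩
  · rw [lambdaOp, (hq z).cexp.deriv, ← hqr]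
    field_simp [Complex.exp_ne_zero]
  · simp only [hqx, bellQ]
    push_cast
    ring_nf

theorem exists_sharp_thetaOp {β : ℝ} (hβ0 : 0 ≤ β)
    (hβ : β < 5 * Real.exp (Real.exp 1 - 1) / (3 * (Real.exp (Real.exp 1 - 1) - 1))) :
    ∃ p : ℂ → ℂ, AnalyticOnNhd ℂ p unitDisc ∧ p 0 = 1 ∧ (∀ z ∈ unitDisc, p z ≠ 0) ∧
      Subordinate (thetaOp β p) phiC ∧ ¬ Subordinate p bellQ := by
  have he0 := Real.exp_one_gt_d9
  have hE1 : 1 < Real.exp (Real.exp 1 - 1) := Real.one_lt_exp_iff.2 (by linarith)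
  have hinv : Real.exp (1 - Real.exp 1) = (Real.exp (Real.exp 1 - 1))⁻¹ := by
    rw [← Real.exp_neg, neg_sub]
  have hpos := Real.exp_pos (1 - Real.exp 1)
  have hlt1 : Real.exp (1 - Real.exp 1) < 1 := by
    rw [hinv]; exact inv_lt_one_of_one_lt₀ hE1
  obtain ⟨q, q', r, x, hq, hq0, hr0, hr1, hqr, hx, hqx, hq1⟩ := exists_extremal_pos hβ0
    (τ := 1 - Real.exp (1 - Real.exp 1)) (by linarith) (by linarith) (by
      rw [lt_div_iff₀ (by linarith)] at hβ
      have hE : Real.exp (Real.exp 1 - 1) * Real.exp (1 - Real.exp 1) = 1 := by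
        rw [← Real.exp_add]; simp
      nlinarith)
  have hne : ∀ z, ‖z‖ < 1 → 1 - q z ≠ 0 := fun z hz h => by
    simpa [h] using one_sub_re_pos (hq1 z hz)
  refine ⟨fun z => (1 - q z)⁻¹, analyticOnNhd_unitDisc fun z hz =>
    ((hq z).differentiableAt.const_sub 1).inv (hne z hz), by simp [hq0],
    fun z hz => inv_ne_zero (hne z (mem_unitDisc.1 hz)),
    subordinate_phiC_of_dilation hr0 hr1 fun z hz => ?_,
    not_subordinate_bellQ (ζ := 1) hx (by simp) ?_⟩
  · have := hne z hz
    have hd : HasDerivAt (fun z => (1 - q z)⁻¹) _ z := ((hq z).const_sub 1).inv this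
    rw [thetaOp, hd.deriv, ← hqr]
    field_simp
  · simp only [hqx, bellQ]
    rw [Complex.ofReal_sub, Complex.ofReal_one, sub_sub_cancel, Complex.ofReal_exp,
      ← Complex.exp_neg]
    push_cast
    ring_nf

/-- For each of the three operators: above the stated bound the subordination to `phiC` forces
`p ≺ bellQ`, and for no smaller nonnegative `β` does this implication hold.

In the second and third case `p` is not assumed to be zero-free: at a zero of `p` the quotient is
undefined in the usual reading and Lean's convention makes it `0`, but it is unbounded near such a
zero, so the subordination hypothesis fails under either reading. The functions witnessing
sharpness are required to be zero-free in these cases, so that the quotients are genuine. -/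
theorem theorem2p10 :
    ((∀ β : ℝ, 1 / (1 - Real.exp (Real.exp (-1) - 1)) ≤ β →
        ∀ p : ℂ → ℂ, AnalyticOnNhd ℂ p unitDisc → p 0 = 1 →
          Subordinate (psiOp β p) phiC → Subordinate p bellQ) ∧
      (∀ β : ℝ, 0 ≤ β → β < 1 / (1 - Real.exp (Real.exp (-1) - 1)) →
        ∃ p : ℂ → ℂ, AnalyticOnNhd ℂ p unitDisc ∧ p 0 = 1 ∧
          Subordinate (psiOp β p) phiC ∧ ¬ Subordinate p bellQ)) ∧
    ((∀ β : ℝ, Real.exp 1 / (Real.exp 1 - 1) ≤ β →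
        ∀ p : ℂ → ℂ, AnalyticOnNhd ℂ p unitDisc → p 0 = 1 →
          Subordinate (lambdaOp β p) phiC → Subordinate p bellQ) ∧
      (∀ β : ℝ, 0 ≤ β → β < Real.exp 1 / (Real.exp 1 - 1) →
        ∃ p : ℂ → ℂ, AnalyticOnNhd ℂ p unitDisc ∧ p 0 = 1 ∧ (∀ z ∈ unitDisc, p z ≠ 0) ∧
          Subordinate (lambdaOp β p) phiC ∧ ¬ Subordinate p bellQ)) ∧
    ((∀ β : ℝ, 5 * Real.exp (Real.exp 1 - 1) / (3 * (Real.exp (Real.exp 1 - 1) - 1)) ≤ β →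
        ∀ p : ℂ → ℂ, AnalyticOnNhd ℂ p unitDisc → p 0 = 1 →
          Subordinate (thetaOp β p) phiC → Subordinate p bellQ) ∧
      (∀ β : ℝ, 0 ≤ β →
          β < 5 * Real.exp (Real.exp 1 - 1) / (3 * (Real.exp (Real.exp 1 - 1) - 1)) →
        ∃ p : ℂ → ℂ, AnalyticOnNhd ℂ p unitDisc ∧ p 0 = 1 ∧ (∀ z ∈ unitDisc, p z ≠ 0) ∧
          Subordinate (thetaOp β p) phiC ∧ ¬ Subordinate p bellQ)) := by
  exact ⟨⟨fun β hβ p hp hp0 h => subordinate_of_psiOp hβ hp hp0 h,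
      fun β hβ0 hβ => exists_sharp_psiOp hβ0 hβ⟩,
    ⟨fun β hβ p hp hp0 h => subordinate_of_lambdaOp hβ hp hp0 h,
      fun β hβ0 hβ => exists_sharp_lambdaOp hβ0 hβ⟩,
    ⟨fun β hβ p hp hp0 h => subordinate_of_thetaOp hβ hp hp0 h,
      fun β hβ0 hβ => exists_sharp_thetaOp hβ0 hβ⟩⟩
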